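/- Notation. All Hilbert spaces are finite dimensional, states are positive semidefinite operators of trace $1$, and $\log$ is to base $2$. For states $\rho,\sigma$ let $F(\rho,\sigma)=\|\sqrt\rho\sqrt\sigma\|_1$ be the fidelity and $P(\rho,\sigma)=\sqrt{1-F(\rho,\sigma)^2}$ the purified distance. Let $D_{\max}(\rho\|\sigma)=\inf\{\lambda\in\mathbb R:\rho\le 2^{\lambda}\sigma\}$ (with $\inf\emptyset=+\infty$), let $D_{\max}^{\epsilon}(\rho\|\sigma)=\inf_{\rho'}D_{\max}(\rho'\|\sigma)$ over all states $\rho'$ with $P(\rho',\rho)\le\epsilon$, and let $I_{\max}^{\epsilon}(A:B)_\rho=D_{\max}^{\epsilon}(\rho^{AB}\|\rho^A\otimes\rho^B)$. Setting. Let $P_X,P_Y$ be probability distributions on finite alphabets $\mathcal X,\mathcal Y$, and let $(\rho_{x,y}^{CE})_{x\in\mathcal X,\,y\in\mathcal Y}$ be states on $C\otimes E$. Put $$\rho^{XYCE}=\sum_{x,y}P_X(x)P_Y(y)\,|x\rangle\langle x|^X\otimes|y\rangle\langle y|^Y\otimes\rho_{x,y}^{CE},$$ with marginal $\rho^E$.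 A splitting of $P_X$ consists of a function $f:\mathcal X\times\mathcal X\to\mathcal X$ and, for every $\theta\in[0,1]$, independent random variables $U^\theta,V^\theta$ on $\mathcal X$ with distributions $P_U^\theta,P_V^\theta$ such that: (1) $f(U^\theta,V^\theta)\sim P_X$ for all $\theta$; (2) the conditional law of $f(U^\theta,V^\theta)$ given $U^\theta$ is $P_X$ for $\theta=0$, and is a point mass for $\theta=1$; (3) for each fixed $u$, the law of $f(u,V^\theta)$ is continuous in $\theta\in[0,1]$. (An example, when $\mathcal X$ is linearly ordered, is $f=\max$, $\Pr[U^\theta\le u]=\theta\Pr[X\le u]+1-\theta$, $\Pr[V^\theta\le v]=\Pr[X\le v]/\Pr[U^\theta\le v]$.) Given a splitting, let $\rho(\theta)^{CE}_{u,y,v}=\rho^{CE}_{f(u,v),y}$, with marginal $\rho(\theta)^{E}_{u,y,v}$ on $E$, and $$\rho_\theta^{UVYCE}=\sum_{u,v,y}P_U^\theta(u)P_V^\theta(v)P_Y(y)\,|u\rangle\langle u|^U\otimes|v\rangle\langle v|^V\otimes|y\rangle\langle y|^Y\otimes\rho_{f(u,v),y}^{CE}.$$ Theorem. There is an absolute constant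 $c$ such that the following holds for every such $P_X,P_Y,(\rho_{x,y}^{CE})$, every splitting of $P_X$, every $\theta\in[0,1]$, all reals $\delta>0$ and $0<\epsilon'<\delta$, and all positive integers $K_1,K_2,K_3$. If $$\log K_1\ge I_{\max}^{\delta-\epsilon'}(U:E)_{\rho_\theta}+\log\tfrac{3}{\epsilon'^3}-\tfrac14\log\delta,$$ $$\log K_2\ge I_{\max}^{\delta-\epsilon'}(Y:EU)_{\rho_\theta}+\log\tfrac{3}{\epsilon'^3}-\tfrac14\log\delta+c,$$ $$\log K_3\ge I_{\max}^{\delta-\epsilon'}(V:EYU)_{\rho_\theta}+\log\tfrac{3}{\epsilon'^3}-\tfrac14\log\delta+c,$$ then, for independent samples $u_1,\dots,u_{K_1}\sim P_U^\theta$, $y_1,\dots,y_{K_2}\sim P_Y$ and $v_1,\dots,v_{K_3}\sim P_V^\theta$, $$\mathbb E\,\Bigl\|\frac1{K_1K_2K_3}\sum_{i=1}^{K_1}\sum_{j=1}^{K_2}\sum_{k=1}^{K_3}\rho(\theta)^E_{u_i,y_j,v_k}-\rho^E\Bigr\|_1\le 40\,\delta^{1/8},$$ where $\|\cdot\|_1$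 is the trace norm. -/

import Mathlib

open scoped ComplexOrder MatrixOrder Kronecker

/-! ### States, partial traces, distances -/

noncomputable section Quantum

variable {A B : Type*} [Fintype A] [DecidableEq A] [Fintype B] [DecidableEq B]

/-- A (normalised) quantum state on the finite dimensional Hilbert space `ℂ^A`. -/
def IsState (ρ : Matrix A A ℂ) : Prop :=
  ρ.PosSemidef ∧ ρ.trace = 1

/-- The rank one projector `|a⟩⟨a|` on a basis vector. -/
def ketbra (a : A) : Matrix A A ℂ := Matrix.single a a 1

/-- The partial trace over the second system: `ρ^{AB} ↦ ρ^A`. -/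
def traceRight (ρ : Matrix (A × B) (A × B) ℂ) : Matrix A A ℂ :=
  Matrix.of fun a a' => ∑ b, ρ (a, b) (a', b)

/-- The partial trace over the first system: `ρ^{AB} ↦ ρ^B`. -/
def traceLeft (ρ : Matrix (A × B) (A × B) ℂ) : Matrix B B ℂ :=
  Matrix.of fun b b' => ∑ a, ρ (a, b) (a, b')

/-- The trace norm (Schatten `1`-norm) `‖M‖₁ = Tr |M|`, with `|M| = √(Mᴴ M)`. -/
def traceNorm (M : Matrix A A ℂ) : ℝ := (CFC.abs M).trace.re

/-- The fidelity `F(ρ, σ) = ‖√ρ √σ‖₁`. -/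
def fidelity (ρ σ : Matrix A A ℂ) : ℝ := traceNorm (CFC.sqrt ρ * CFC.sqrt σ)

/-- The purified distance `P(ρ, σ) = √(1 - F(ρ, σ)²)`. -/
def purifiedDistance (ρ σ : Matrix A A ℂ) : ℝ := √(1 - fidelity ρ σ ^ 2)

/-- The max relative entropy `D_max(ρ ‖ σ) = inf {l | ρ ≤ 2^l σ}` for the Löwner order;
it is `⊤` if there is no such `l`. -/
def Dmax (ρ σ : Matrix A A ℂ) : EReal :=
  ⨅ (l : ℝ) (_ : ρ ≤ ((2 : ℝ) ^ l) • σ), (l : EReal)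

/-- The smooth max relative entropy: the infimum of `D_max(ρ' ‖ σ)` over the states `ρ'`
in the `ε`-ball around `ρ` for the purified distance. -/
def smoothDmax (ε : ℝ) (ρ σ : Matrix A A ℂ) : EReal :=
  ⨅ (ρ' : Matrix A A ℂ) (_ : IsState ρ' ∧ purifiedDistance ρ' ρ ≤ ε), Dmax ρ' σ

/-- The smooth max mutual information
`I_max^ε(A : B)_ρ = D_max^ε(ρ^{AB} ‖ ρ^A ⊗ ρ^B)`. -/
def smoothImax (ε : ℝ) (ρ : Matrix (A × B) (A × B) ℂ) : EReal :=
  smoothDmax ε ρ (traceRight ρ ⊗ₖ traceLeft ρ)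

end Quantum

/-! ### Splitting of a distribution -/

/-- The law of `f(u, V)` for `V` with distribution `PV`. If `U` and `V` are independent, it is the
conditional law of `f(U, V)` given `U = u`. -/
def splitLaw {X : Type*} [Fintype X] [DecidableEq X] (PV : X → ℝ) (f : X → X → X) (u x : X) : ℝ :=
  ∑ v, if f u v = x then PV v else 0

/-- A splitting of the distribution `PX` on the finite alphabet `X`: a family, indexed by
`θ ∈ [0, 1]`, of pairs of distributions `P_U^θ`, `P_V^θ` (of independent random variables
`U^θ`, `V^θ`), and a splitting function `f`. -/
structure RateSplit {X : Type*} [Fintype X] [DecidableEq X] (PX : X → ℝ) where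
  PU : unitInterval → X → ℝ
  PV : unitInterval → X → ℝ
  f : X → X → X
  PU_mem : ∀ θ, PU θ ∈ stdSimplex ℝ X
  PV_mem : ∀ θ, PV θ ∈ stdSimplex ℝ X
  /-- `f(U^θ, V^θ)` has distribution `PX`. -/
  law_eq : ∀ θ x, ∑ u, PU θ u * splitLaw (PV θ) f u x = PX x
  /-- For `θ = 0`, the conditional law of `f(U^θ, V^θ)` given `U^θ` is `PX`. -/
  law_zero : ∀ u, PU 0 u ≠ 0 → ∀ x, splitLaw (PV 0) f u x = PX x
  /-- For `θ = 1`, the conditional law of `f(U^θ, V^θ)` given `U^θ` is a point mass. -/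
  law_one : ∀ u, PU 1 u ≠ 0 → ∃ x, splitLaw (PV 1) f u x = 1
  /-- For fixed `u`, the law of `f(u, V^θ)` is continuous in `θ`. -/
  law_continuous : ∀ u x, Continuous fun θ => splitLaw (PV θ) f u x

/-! ### The control states -/

noncomputable section ControlStates

variable {X Y C E : Type*} [Fintype X] [DecidableEq X] [Fintype Y] [DecidableEq Y]
  [Fintype C] [Fintype E]

/-- The control state
`ρ^{XYCE} = ∑ P_X(x) P_Y(y) |x⟩⟨x| ⊗ |y⟩⟨y| ⊗ ρ_{x,y}^{CE}` of the channel `(x, y) ↦ ρ_{x,y}^{CE}`. -/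
def controlState (PX : X → ℝ) (PY : Y → ℝ) (ρ : X → Y → Matrix (C × E) (C × E) ℂ) :
    Matrix (X × Y × C × E) (X × Y × C × E) ℂ :=
  ∑ x, ∑ y, (PX x * PY y) • (ketbra x ⊗ₖ (ketbra y ⊗ₖ ρ x y))

/-- The rate-split control state
`ρ_θ^{UVYCE} = ∑ P_U(u) P_V(v) P_Y(y) |u⟩⟨u| ⊗ |v⟩⟨v| ⊗ |y⟩⟨y| ⊗ ρ_{f(u,v),y}^{CE}`. -/
def rateSplitState (PU PV : X → ℝ) (f : X → X → X) (PY : Y → ℝ)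
    (ρ : X → Y → Matrix (C × E) (C × E) ℂ) :
    Matrix (X × X × Y × C × E) (X × X × Y × C × E) ℂ :=
  ∑ u, ∑ v, ∑ y, (PU u * PV v * PY y) • (ketbra u ⊗ₖ (ketbra v ⊗ₖ (ketbra y ⊗ₖ ρ (f u v) y)))

variable {U V : Type*} [Fintype U] [Fintype V]

/-- The marginal of a state of `UVYCE` on `UE`, as a state on `U` and `E`. -/
def marginalU_E (σ : Matrix (U × V × Y × C × E) (U × V × Y × C × E) ℂ) :
    Matrix (U × E) (U × E) ℂ :=
  let r : (U × E) × (V × Y × C) → U × V × Y × C × E := fun ((u, e), (v, y, c)) => (u, v, y, c, e)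
  traceRight (σ.submatrix r r)

/-- The marginal of a state of `UVYCE` on `YEU`, as a state on `Y` and `EU`. -/
def marginalY_EU (σ : Matrix (U × V × Y × C × E) (U × V × Y × C × E) ℂ) :
    Matrix (Y × (E × U)) (Y × (E × U)) ℂ :=
  let r : (Y × (E × U)) × (V × C) → U × V × Y × C × E := fun ((y, (e, u)), (v, c)) => (u, v, y, c, e)
  traceRight (σ.submatrix r r)

/-- The marginal of a state of `UVYCE` on `VEYU`, as a state on `V` and `EYU`. -/
def marginalV_EYU (σ : Matrix (U × V × Y × C × E) (U × V × Y × C × E) ℂ) :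
    Matrix (V × (E × Y × U)) (V × (E × Y × U)) ℂ :=
  let r : (V × (E × Y × U)) × C → U × V × Y × C × E := fun ((v, (e, y, u)), c) => (u, v, y, c, e)
  traceRight (σ.submatrix r r)

/-- The expectation of `g(a_1, …, a_K)` for `K` i.i.d. samples `a_i` from the distribution `P`. -/
def iidExpect {α : Type*} [Fintype α] (P : α → ℝ) (K : ℕ) (g : (Fin K → α) → ℝ) : ℝ :=
  ∑ a : Fin K → α, (∏ i, P (a i)) * g a

end ControlStates

/-! ### The max construction

The standard example of a splitting: `f = max`, `Pr[U ≤ u] = θ Pr[X ≤ u] + 1 - θ` and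
`Pr[V ≤ v] = Pr[X ≤ v] / Pr[U ≤ v]`. -/

noncomputable section MaxConstruction

variable {X : Type*} [Fintype X] [LinearOrder X]

/-- `Pr[X ≤ x]`. -/
def cdfLE (P : X → ℝ) (x : X) : ℝ := ∑ x' with x' ≤ x, P x'

/-- `Pr[X < x]`. -/
def cdfLT (P : X → ℝ) (x : X) : ℝ := ∑ x' with x' < x, P x'

/-- The distribution `P_U^θ` of the max construction. -/
def maxPU (P : X → ℝ) (θ : unitInterval) (u : X) : ℝ :=
  θ * P u + if ∀ x, u ≤ x then 1 - (θ : ℝ) else 0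

/-- The function `t ↦ t / (θ t + 1 - θ)`. -/
def splitRatio (θ : unitInterval) (t : ℝ) : ℝ := t / (θ * t + 1 - θ)

/-- The distribution `P_V^θ` of the max construction. -/
def maxPV (P : X → ℝ) (θ : unitInterval) (v : X) : ℝ :=
  splitRatio θ (cdfLE P v) - splitRatio θ (cdfLT P v)

lemma splitRatio_zero (θ : unitInterval) : splitRatio θ 0 = 0 := by simp [splitRatio]

lemma splitRatio_mono (θ : unitInterval) {s t : ℝ} (hs : 0 ≤ s) (hst : s ≤ t) :
    splitRatio θ s ≤ splitRatio θ t := by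
  have h0 := θ.2.1
  have h1 := θ.2.2
  unfold splitRatio
  rcases eq_or_lt_of_le hs with h | h
  · subst h
    simp only [zero_div]
    have : 0 ≤ (θ : ℝ) * t := mul_nonneg h0 hst
    exact div_nonneg hst (by linarith)
  · have key : ∀ r : ℝ, 0 < r → 0 < (θ : ℝ) * r + 1 - θ := by
      intro r hr
      rcases eq_or_lt_of_le h1 with h | h
      · rw [h]; linarith
      · have := mul_nonneg h0 hr.le
        linarith
    rw [div_le_div_iff₀ (key s h) (key t (h.trans_le hst))]
    nlinarith [mul_le_mul_of_nonneg_left hst (sub_nonneg.2 h1)]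

lemma splitRatio_mul (θ : unitInterval) {t : ℝ} (ht : 0 ≤ t) :
    (θ * t + 1 - θ) * splitRatio θ t = t := by
  have h0 := θ.2.1
  have h1 := θ.2.2
  unfold splitRatio
  by_cases h : (θ : ℝ) * t + 1 - θ = 0
  · have h2 := mul_nonneg h0 ht
    have h3 : (θ : ℝ) = 1 := by linarith
    rw [h3] at h
    rw [h3]
    have : t = 0 := by linarith
    simp [this]
  · field_simp

lemma continuous_splitRatio {t : ℝ} (ht : 0 ≤ t) : Continuous fun θ => splitRatio θ t := by
  rcases eq_or_lt_of_le ht with h | h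
  · subst h
    simpa [splitRatio_zero] using continuous_const
  · unfold splitRatio
    refine continuous_const.div (by fun_prop) ?_
    intro θ
    have h0 := θ.2.1
    have h1 := θ.2.2
    rcases eq_or_lt_of_le h1 with h2 | h2
    · rw [h2]; intro h3; linarith
    · have := mul_nonneg h0 ht
      intro h3; linarith

lemma sum_telescope (P : X → ℝ) (A : ℝ → ℝ) (hA : A 0 = 0) (s : Finset X) :
    ∑ v ∈ s, (A (∑ x ∈ s with x ≤ v, P x) - A (∑ x ∈ s with x < v, P x)) = A (∑ x ∈ s, P x) := by
  induction s using Finset.induction_on_max with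
  | empty => simp [hA]
  | insert a s hs ih =>
    have ha : a ∉ s := fun h => lt_irrefl _ (hs a h)
    rw [Finset.sum_insert ha]
    have e1 : ({x ∈ insert a s | x ≤ a} : Finset X) = insert a s := by
      ext x; simp only [Finset.mem_filter, Finset.mem_insert]
      exact ⟨fun h => h.1, fun h => ⟨h, h.elim (fun h => h.le) (fun h => (hs x h).le)⟩⟩
    have e2 : ({x ∈ insert a s | x < a} : Finset X) = s := by
      ext x; simp only [Finset.mem_filter, Finset.mem_insert]
      exact ⟨fun h => h.1.resolve_left h.2.ne, fun h => ⟨Or.inr h, hs x h⟩⟩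
    have e3 : ∀ v ∈ s, ({x ∈ insert a s | x ≤ v} : Finset X) = {x ∈ s | x ≤ v} := by
      intro v hv
      rw [Finset.filter_insert, if_neg (not_le.2 (hs v hv))]
    have e4 : ∀ v ∈ s, ({x ∈ insert a s | x < v} : Finset X) = {x ∈ s | x < v} := by
      intro v hv
      rw [Finset.filter_insert, if_neg (not_lt.2 (hs v hv).le)]
    have e5 : ∑ v ∈ s, (A (∑ x ∈ insert a s with x ≤ v, P x) - A (∑ x ∈ insert a s with x < v, P x))
        = A (∑ x ∈ s, P x) := by
      rw [← ih]
      exact Finset.sum_congr rfl fun v hv => by rw [e3 v hv, e4 v hv]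
    rw [e1, e2, e5]
    ring

lemma cdfLE_nonneg {P : X → ℝ} (hP : P ∈ stdSimplex ℝ X) (x : X) : 0 ≤ cdfLE P x :=
  Finset.sum_nonneg fun _ _ => hP.1 _

lemma cdfLT_nonneg {P : X → ℝ} (hP : P ∈ stdSimplex ℝ X) (x : X) : 0 ≤ cdfLT P x :=
  Finset.sum_nonneg fun _ _ => hP.1 _

lemma cdfLE_eq (P : X → ℝ) (x : X) : cdfLE P x = cdfLT P x + P x := by
  have : ({x' | x' ≤ x} : Finset X) = insert x ({x' | x' < x} : Finset X) := by
    ext y; simp [le_iff_eq_or_lt]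
  unfold cdfLE cdfLT
  rw [this, Finset.sum_insert (by simp)]
  ring

lemma maxPV_nonneg {P : X → ℝ} (hP : P ∈ stdSimplex ℝ X) (θ : unitInterval) (v : X) :
    0 ≤ maxPV P θ v :=
  sub_nonneg.2 (splitRatio_mono θ (cdfLT_nonneg hP v)
    (by rw [cdfLE_eq]; linarith [hP.1 v]))

/-- `Pr[U^θ ≤ u] = θ Pr[X ≤ u] + 1 - θ`. -/
lemma cdfLE_maxPU (P : X → ℝ) (θ : unitInterval) (u : X) :
    cdfLE (maxPU P θ) u = θ * cdfLE P u + 1 - θ := by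
  have hne : (Finset.univ : Finset X).Nonempty := ⟨u, Finset.mem_univ _⟩
  set m := Finset.univ.min' hne with hm
  have hmin : ∀ x, m ≤ x := fun x => Finset.min'_le _ _ (Finset.mem_univ _)
  have h1 : ∀ x : X, (if ∀ y, x ≤ y then 1 - (θ : ℝ) else 0) = if x = m then 1 - (θ : ℝ) else 0 := by
    intro x
    refine if_congr ⟨fun h => le_antisymm (h m) (hmin x), fun h => h ▸ hmin⟩ rfl rfl
  unfold cdfLE maxPU
  rw [Finset.sum_add_distrib, ← Finset.mul_sum, Finset.sum_congr rfl fun x _ => h1 x,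
    Finset.sum_ite_eq' _ m, if_pos (by simp [hmin])]
  ring

/-- `Pr[V^θ ≤ v] = Pr[X ≤ v] / Pr[U^θ ≤ v]`. -/
lemma cdfLE_maxPV (P : X → ℝ) (θ : unitInterval) (v : X) :
    cdfLE (maxPV P θ) v = cdfLE P v / cdfLE (maxPU P θ) v := by
  rw [cdfLE_maxPU]
  have h := sum_telescope P (splitRatio θ) (splitRatio_zero θ) ({x | x ≤ v} : Finset X)
  refine Eq.trans (Finset.sum_congr rfl fun w hw => ?_) h
  have hw' : w ≤ v := by simpa using hw
  unfold maxPV cdfLE cdfLT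
  congr 3
  · ext x; simp only [Finset.mem_filter, Finset.mem_univ, true_and]
    exact ⟨fun h => ⟨h.trans hw', h⟩, fun h => h.2⟩
  · ext x; simp only [Finset.mem_filter, Finset.mem_univ, true_and]
    exact ⟨fun h => ⟨h.le.trans hw', h⟩, fun h => h.2⟩

lemma cdfLE_injective {a b : X → ℝ} (h : ∀ x, cdfLE a x = cdfLE b x) : a = b := by
  have hwf : WellFounded ((· < ·) : X → X → Prop) := wellFounded_lt
  funext x
  induction x using hwf.induction with
  | _ x ih =>
    have h1 := h x
    rw [cdfLE_eq, cdfLE_eq] at h1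
    have h2 : cdfLT a x = cdfLT b x :=
      Finset.sum_congr rfl fun y hy => ih y (by simpa using hy)
    linarith

lemma sum_eq_cdfLE (a : X → ℝ) {m : X} (hm : ∀ x, x ≤ m) : ∑ x, a x = cdfLE a m := by
  unfold cdfLE
  rw [Finset.filter_true_of_mem fun x _ => hm x]

lemma exists_le_of_mem_stdSimplex {P : X → ℝ} (hP : P ∈ stdSimplex ℝ X) : ∃ m : X, ∀ x, x ≤ m := by
  have hne : (Finset.univ : Finset X).Nonempty := by
    by_contra h
    rw [Finset.not_nonempty_iff_eq_empty] at h
    have := hP.2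
    rw [h] at this
    simp at this
  exact ⟨Finset.univ.max' hne, fun x => Finset.le_max' _ _ (Finset.mem_univ _)⟩

lemma maxPU_mem {P : X → ℝ} (hP : P ∈ stdSimplex ℝ X) (θ : unitInterval) :
    maxPU P θ ∈ stdSimplex ℝ X := by
  obtain ⟨m, hm⟩ := exists_le_of_mem_stdSimplex hP
  refine ⟨fun x => add_nonneg (mul_nonneg θ.2.1 (hP.1 x)) ?_, ?_⟩
  · split_ifs
    · exact sub_nonneg.2 θ.2.2
    · exact le_rfl
  · rw [sum_eq_cdfLE _ hm, cdfLE_maxPU, ← sum_eq_cdfLE _ hm, hP.2]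
    ring

lemma maxPV_mem {P : X → ℝ} (hP : P ∈ stdSimplex ℝ X) (θ : unitInterval) :
    maxPV P θ ∈ stdSimplex ℝ X := by
  obtain ⟨m, hm⟩ := exists_le_of_mem_stdSimplex hP
  refine ⟨maxPV_nonneg hP θ, ?_⟩
  rw [sum_eq_cdfLE _ hm, cdfLE_maxPV, cdfLE_maxPU, ← sum_eq_cdfLE _ hm, hP.2]
  simp

lemma law_max {P : X → ℝ} (hP : P ∈ stdSimplex ℝ X) (θ : unitInterval) (x : X) :
    ∑ u, maxPU P θ u * splitLaw (maxPV P θ) max u x = P x := by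
  have key : (fun x => ∑ u, maxPU P θ u * splitLaw (maxPV P θ) max u x) = P := by
    refine cdfLE_injective fun w => ?_
    have h1 : ∀ u, ∑ x with x ≤ w, splitLaw (maxPV P θ) max u x
        = if u ≤ w then cdfLE (maxPV P θ) w else 0 := by
      intro u
      unfold splitLaw
      rw [Finset.sum_comm]
      have : ∀ v, (∑ x with x ≤ w, if max u v = x then maxPV P θ v else 0)
          = if u ≤ w then (if v ≤ w then maxPV P θ v else 0) else 0 := by
        intro v
        rw [Finset.sum_ite_eq, ← ite_and]
        simp
      simp_rw [this]
      split_ifs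
      · rw [← Finset.sum_filter]; rfl
      · simp
    have h2 : cdfLE (fun x => ∑ u, maxPU P θ u * splitLaw (maxPV P θ) max u x) w
        = cdfLE (maxPU P θ) w * cdfLE (maxPV P θ) w := by
      change ∑ x with x ≤ w, ∑ u, _ = _
      rw [Finset.sum_comm]
      simp_rw [← Finset.mul_sum, h1]
      simp only [mul_ite, mul_zero]
      rw [← Finset.sum_filter, ← Finset.sum_mul]
      rfl
    rw [h2, cdfLE_maxPV, cdfLE_maxPU]
    exact splitRatio_mul θ (cdfLE_nonneg hP w)
  exact congrFun key x

/-- The max construction is a splitting of `P`. -/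
def maxSplit (P : X → ℝ) (hP : P ∈ stdSimplex ℝ X) : RateSplit P where
  PU := maxPU P
  PV := maxPV P
  f := max
  PU_mem := maxPU_mem hP
  PV_mem := maxPV_mem hP
  law_eq := law_max hP
  law_zero := by
    intro u hu x
    have hmin : ∀ y, u ≤ y := by
      by_contra h
      exact hu (by simp [maxPU, h])
    have : ∀ v, max u v = v := fun v => max_eq_right (hmin v)
    simp only [splitLaw, this, Finset.sum_ite_eq', Finset.mem_univ, if_true]
    simp [maxPV, splitRatio, cdfLE_eq]
  law_one := by
    intro u _
    have h01 : ∀ v, maxPV P 1 v = 0 ∨ maxPV P 1 v = 1 := by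
      intro v
      have h := maxPV_nonneg hP 1 v
      have hr : ∀ t : ℝ, splitRatio 1 t = 0 ∨ splitRatio 1 t = 1 := by
        intro t
        by_cases ht : t = 0
        · simp [splitRatio, ht]
        · simp [splitRatio, ht]
      unfold maxPV at h ⊢
      rcases hr (cdfLE P v) with h1 | h1 <;> rcases hr (cdfLT P v) with h2 | h2 <;>
        rw [h1, h2] at h ⊢
      · left; norm_num
      · norm_num at h
      · right; norm_num
      · left; norm_num
    have hsum := (maxPV_mem hP 1).2
    obtain ⟨v, hv⟩ : ∃ v, maxPV P 1 v = 1 := by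
      by_contra! h
      rw [Finset.sum_eq_zero fun v _ => (h01 v).resolve_right (h v)] at hsum
      exact zero_ne_one hsum
    refine ⟨max u v, le_antisymm ?_ ?_⟩
    · rw [← hsum]
      refine Finset.sum_le_sum fun w _ => ?_
      split_ifs
      · exact le_rfl
      · exact maxPV_nonneg hP 1 w
    · rw [← hv]
      unfold splitLaw
      refine le_trans (by simp) (Finset.single_le_sum (f := fun w =>
        if max u w = max u v then maxPV P 1 w else 0) (fun w _ => ?_) (Finset.mem_univ v))
      split_ifs
      · exact maxPV_nonneg hP 1 w
      · exact le_rfl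
  law_continuous := by
    intro u x
    refine continuous_finsetSum _ fun v _ => ?_
    split_ifs
    · exact (continuous_splitRatio (cdfLE_nonneg hP v)).sub
        (continuous_splitRatio (cdfLT_nonneg hP v))
    · exact continuous_const

end MaxConstruction

/-! The proof replaces the triple average by its mean one variable at a time. With `m2 u y` the mean
over `v`, `m1 u` the mean over `y` as well, and `m0 = ρE`, the deviation telescopes into (average
over `k` minus `m2`), (average over `j` minus `m1`) and (average over `i` minus `m0`). By the
triangle inequality each is a one-variable covering problem, conditioned on the classical variables
sampled outside it (`iidExpect_three_traceNorm_le`).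

The covering bound (`iidExpect_traceNorm_le_of_smoothImax_add_le`) is a second moment argument. A
near-optimal smoothing state yields operators `R a`, close to `r a` on average and dominated by `L •
σ`, where `σ` is the mean and `L ≤ K δ³`. For `T` dominating every `R a`, weighted Cauchy–Schwarz
bounds the trace norm of the fluctuation `Z` by `Tr T` and `Tr (Z T⁻¹ Z)`. Independence kills the
cross terms of the latter, and `R a ≤ T` gives `Tr (R T⁻¹ R) ≤ Tr R`, so its mean is at most `1/K`.
The smoothing error is controlled by a Fuchs–van de Graaf type bound and pinching.

Side information `z` of weight `w z` is absorbed by running the same bound on block diagonal states.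
Each of the three terms costs `12 δ`, and `36 δ ≤ 40 δ^(1/8)` for `δ < 1`; for `δ ≥ 1` the trivial
bound `2` suffices. -/

set_option linter.unusedSectionVars false
set_option linter.unusedDecidableInType false
set_option linter.unusedFintypeInType false

/-! ### Duality between the trace norm and contractions -/

section TraceNorm

variable {n m o : Type*} [Fintype n] [DecidableEq n] [Fintype m] [DecidableEq m]
  [Fintype o] [DecidableEq o]

namespace Matrix

lemma PosSemidef.re_trace_nonneg {A : Matrix n n ℂ} (hA : A.PosSemidef) : 0 ≤ A.trace.re :=
  (Complex.nonneg_iff.1 hA.trace_nonneg).1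

lemma PosSemidef.exists_eq_conjTranspose_mul_self {A : Matrix n n ℂ} (hA : A.PosSemidef) :
    ∃ S : Matrix n n ℂ, A = Sᴴ * S := by
  obtain ⟨S, hS⟩ := CStarAlgebra.nonneg_iff_eq_star_mul_self.1 (nonneg_iff_posSemidef.2 hA)
  exact ⟨S, hS⟩

lemma PosSemidef.re_trace_mul_nonneg {A B : Matrix n n ℂ} (hA : A.PosSemidef)
    (hB : B.PosSemidef) : 0 ≤ (A * B).trace.re := by
  obtain ⟨S, rfl⟩ := hA.exists_eq_conjTranspose_mul_self
  rw [Matrix.mul_assoc, trace_mul_comm]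
  exact (hB.mul_mul_conjTranspose_same S).re_trace_nonneg

lemma PosSemidef.re_trace_mul_le {A B : Matrix n n ℂ} (hA : A.PosSemidef)
    (hB : (1 - B).PosSemidef) : (A * B).trace.re ≤ A.trace.re := by
  have := hA.re_trace_mul_nonneg hB
  rw [Matrix.mul_sub, Matrix.mul_one, trace_sub, Complex.sub_re] at this
  linarith

lemma re_trace_conjTranspose (A : Matrix n n ℂ) : Aᴴ.trace.re = A.trace.re := by
  rw [trace_conjTranspose]; simp

lemma posSemidef_cfcAbs (M : Matrix n n ℂ) : (CFC.abs M).PosSemidef :=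
  nonneg_iff_posSemidef.1 (CFC.abs_nonneg M)

lemma cfcAbs_mul_cfcAbs (M : Matrix n n ℂ) : CFC.abs M * CFC.abs M = Mᴴ * M :=
  CFC.abs_mul_abs M

/-- A Hermitian pseudo-inverse of `|M|`. -/
lemma exists_pinv_cfcAbs (M : Matrix n n ℂ) :
    ∃ G : Matrix n n ℂ, Gᴴ = G ∧ CFC.abs M * G = G * CFC.abs M ∧
      G * CFC.abs M * CFC.abs M = CFC.abs M ∧ G * CFC.abs M * G = G := by
  have hs : IsSelfAdjoint (CFC.abs M) := (posSemidef_cfcAbs M).isHermitian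
  have hc : ∀ f : ℝ → ℝ, ContinuousOn f (spectrum ℝ (CFC.abs M)) := fun f =>
    (finite_real_spectrum (A := CFC.abs M)).continuousOn f
  -- Since `0⁻¹ = 0`, this inverts `|M|` on its range and vanishes on its kernel; continuity is free
  -- on a finite spectrum.
  refine ⟨cfc (fun x : ℝ => x⁻¹) (CFC.abs M), ?_, ?_, ?_, ?_⟩
  · exact cfc_predicate (p := IsSelfAdjoint) (fun x : ℝ => x⁻¹) (CFC.abs M)
  · exact (cfc_commute_cfc id (fun x : ℝ => x⁻¹) (CFC.abs M)).eq |> fun h => by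
      rwa [cfc_id ℝ (CFC.abs M)] at h
  · nth_rewrite 2 [← cfc_id ℝ (CFC.abs M)]
    nth_rewrite 3 [← cfc_id ℝ (CFC.abs M)]
    rw [← cfc_mul _ _ _ (hc _) (hc _), ← cfc_mul _ _ _ (hc _) (hc _)]
    conv_rhs => rw [← cfc_id ℝ (CFC.abs M)]
    congr 1
    funext x
    by_cases hx : x = 0 <;> simp [hx]
  · nth_rewrite 2 [← cfc_id ℝ (CFC.abs M)]
    rw [← cfc_mul _ _ _ (hc _) (hc _), ← cfc_mul _ _ _ (hc _) (hc _)]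
    congr 1
    funext x
    by_cases hx : x = 0 <;> simp [hx]

/-- The complement of an orthogonal projection is again one, hence equal to its own Gram matrix. -/
lemma posSemidef_one_sub_of_isIdempotentElem {p : Matrix n n ℂ}
    (hh : pᴴ = p) (hp : p * p = p) : (1 - p).PosSemidef := by
  have : 1 - p = (1 - p)ᴴ * (1 - p) := by
    rw [conjTranspose_sub, conjTranspose_one, hh, Matrix.mul_sub, Matrix.sub_mul, Matrix.sub_mul,
      hp]
    simp
  rw [this]
  exact posSemidef_conjTranspose_mul_self _

/-- If `W Wᴴ ≤ 1`, then `Re Tr (W M) ≤ ‖M‖₁`. -/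
lemma re_trace_mul_le_traceNorm (M : Matrix n n ℂ) {W : Matrix n n ℂ}
    (hW : (1 - W * Wᴴ).PosSemidef) : (W * M).trace.re ≤ traceNorm M := by
  obtain ⟨G, hG, hc, hT, -⟩ := exists_pinv_cfcAbs M
  unfold traceNorm
  have hTP := posSemidef_cfcAbs M
  have hTh : (CFC.abs M)ᴴ = CFC.abs M := hTP.isHermitian
  have hMM := cfcAbs_mul_cfcAbs M
  set T := CFC.abs M with hTdef
  -- `M` and `T = |M|` have the same kernel, and `G * T` is the projection onto its orthogonal
  -- complement.
  have hM : M * G * T = M := by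
    have h0 : (M * G * T - M)ᴴ * (M * G * T - M) = 0 := by
      have e1 : (M * G * T - M)ᴴ = (T * G - 1) * Mᴴ := by
        simp [conjTranspose_sub, hG, hTh, Matrix.sub_mul, Matrix.mul_assoc]
      have e2 : M * G * T - M = M * (G * T - 1) := by
        simp [Matrix.mul_sub, Matrix.mul_assoc]
      rw [e1, e2]
      have e3 : (T * G - 1) * Mᴴ * (M * (G * T - 1)) = (T * G - 1) * (Mᴴ * M) * (G * T - 1) := by
        simp only [Matrix.mul_assoc]
      rw [e3, ← hMM, hc]
      have : (G * T - 1) * (T * T) = 0 := by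
        rw [Matrix.sub_mul, Matrix.one_mul, ← Matrix.mul_assoc, hT, sub_self]
      rw [this, Matrix.zero_mul]
    exact sub_eq_zero.1 (conjTranspose_mul_self_eq_zero.1 h0)
  -- Completing the square: `M * G` is the partial isometry of the polar decomposition, and
  -- expanding gives `2 Re Tr (W M) ≤ Tr (Wᴴ T W) + Tr T ≤ 2 Tr T`.
  have key := (hTP.mul_mul_conjTranspose_same (Wᴴ - M * G)).re_trace_nonneg
  have e : (Wᴴ - M * G) * T * (Wᴴ - M * G)ᴴ
      = Wᴴ * T * W - Wᴴ * (M * G * T)ᴴ - (M * G * T) * W + (M * G * T) * G * Mᴴ := by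
    simp only [conjTranspose_sub, conjTranspose_mul, conjTranspose_conjTranspose, hG, hTh,
      Matrix.sub_mul, Matrix.mul_sub, Matrix.mul_assoc]
    rw [← Matrix.mul_assoc T G, hc, Matrix.mul_assoc]
    abel
  rw [e, hM] at key
  simp only [trace_add, trace_sub, Complex.add_re, Complex.sub_re] at key
  have t1 : (Wᴴ * T * W).trace.re ≤ T.trace.re := by
    rw [Matrix.mul_assoc, trace_mul_comm, Matrix.mul_assoc]
    exact hTP.re_trace_mul_le hW
  have t2 : (Wᴴ * Mᴴ).trace.re = (W * M).trace.re := by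
    rw [← conjTranspose_mul, re_trace_conjTranspose, trace_mul_comm]
  have t3 : (M * W).trace.re = (W * M).trace.re := by rw [trace_mul_comm]
  have t4 : (M * G * Mᴴ).trace.re = T.trace.re := by
    rw [Matrix.mul_assoc, trace_mul_comm, Matrix.mul_assoc, ← hMM, ← Matrix.mul_assoc, hT]
  linarith

/-- The trace norm is attained by a contraction. -/
lemma exists_contraction_trace_eq_traceNorm (M : Matrix n n ℂ) :
    ∃ W : Matrix n n ℂ, (1 - W * Wᴴ).PosSemidef ∧ (1 - Wᴴ * W).PosSemidef ∧
      (W * M).trace.re = traceNorm M := by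
  obtain ⟨G, hG, hc, hT, hGT⟩ := exists_pinv_cfcAbs M
  have hTP := posSemidef_cfcAbs M
  have hTh : (CFC.abs M)ᴴ = CFC.abs M := hTP.isHermitian
  have hMM := cfcAbs_mul_cfcAbs M
  -- The adjoint of the polar partial isometry `M * G`; both of its Gram matrices are projections.
  refine ⟨G * Mᴴ, ?_, ?_, ?_⟩
  · have e : G * Mᴴ * (G * Mᴴ)ᴴ = G * CFC.abs M := by
      rw [conjTranspose_mul, conjTranspose_conjTranspose, hG, Matrix.mul_assoc,
        ← Matrix.mul_assoc Mᴴ, ← hMM, ← Matrix.mul_assoc, ← Matrix.mul_assoc, hT, hc]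
    rw [e]
    refine posSemidef_one_sub_of_isIdempotentElem ?_ ?_
    · rw [conjTranspose_mul, hG, hTh, hc]
    · rw [Matrix.mul_assoc, ← Matrix.mul_assoc (CFC.abs M), hc, hT]
  · have e : (G * Mᴴ)ᴴ * (G * Mᴴ) = M * (G * G) * Mᴴ := by
      rw [conjTranspose_mul, conjTranspose_conjTranspose, hG]
      simp only [Matrix.mul_assoc]
    rw [e]
    refine posSemidef_one_sub_of_isIdempotentElem ?_ ?_
    · simp [hG, Matrix.mul_assoc]
    · calc M * (G * G) * Mᴴ * (M * (G * G) * Mᴴ)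
          = M * G * (G * (Mᴴ * M) * (G * G)) * Mᴴ := by simp only [Matrix.mul_assoc]
        _ = M * G * (G * CFC.abs M * CFC.abs M * (G * G)) * Mᴴ := by
          rw [← hMM]; simp only [Matrix.mul_assoc]
        _ = M * (G * (CFC.abs M * G) * G) * Mᴴ := by rw [hT]; simp only [Matrix.mul_assoc]
        _ = M * (G * G) * Mᴴ := by
          have : G * (CFC.abs M * G) * G = G * G := by
            rw [← Matrix.mul_assoc, hGT]
          rw [this]
  · rw [Matrix.mul_assoc, ← hMM, ← Matrix.mul_assoc, hT]
    rfl

end Matrix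
end TraceNorm

/-! ### Trace norm inequalities: pinching, weighted Cauchy–Schwarz, Fuchs–van de Graaf -/

section TraceNormBounds

open Matrix

variable {n m o : Type*} [Fintype n] [DecidableEq n] [Fintype m] [DecidableEq m]
  [Fintype o] [DecidableEq o]

lemma traceNorm_nonneg (M : Matrix n n ℂ) : 0 ≤ traceNorm M :=
  (posSemidef_cfcAbs M).re_trace_nonneg

lemma traceNorm_of_posSemidef {M : Matrix n n ℂ} (hM : M.PosSemidef) :
    traceNorm M = M.trace.re := by
  rw [traceNorm, CFC.abs_of_nonneg M (nonneg_iff_posSemidef.2 hM)]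

lemma IsState.traceNorm_eq_one {ρ : Matrix n n ℂ} (h : IsState ρ) : traceNorm ρ = 1 := by
  rw [traceNorm_of_posSemidef h.1, h.2, Complex.one_re]

lemma traceNorm_neg (M : Matrix n n ℂ) : traceNorm (-M) = traceNorm M := by
  rw [traceNorm, CFC.abs_neg, traceNorm]

lemma traceNorm_sub_comm (M N : Matrix n n ℂ) : traceNorm (M - N) = traceNorm (N - M) := by
  rw [← neg_sub, traceNorm_neg]

lemma traceNorm_zero : traceNorm (0 : Matrix n n ℂ) = 0 := by
  rw [traceNorm_of_posSemidef PosSemidef.zero]; simp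

lemma traceNorm_add_le (M N : Matrix n n ℂ) :
    traceNorm (M + N) ≤ traceNorm M + traceNorm N := by
  obtain ⟨W, hW, -, h⟩ := exists_contraction_trace_eq_traceNorm (M + N)
  rw [← h, Matrix.mul_add, trace_add, Complex.add_re]
  exact add_le_add (re_trace_mul_le_traceNorm M hW) (re_trace_mul_le_traceNorm N hW)

lemma traceNorm_sub_le (M N : Matrix n n ℂ) :
    traceNorm (M - N) ≤ traceNorm M + traceNorm N := by
  rw [sub_eq_add_neg, ← traceNorm_neg N]
  exact traceNorm_add_le _ _

lemma traceNorm_sum_le {ι : Type*} (s : Finset ι) (M : ι → Matrix n n ℂ) :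
    traceNorm (∑ i ∈ s, M i) ≤ ∑ i ∈ s, traceNorm (M i) :=
  Finset.le_sum_of_subadditive traceNorm traceNorm_zero.le traceNorm_add_le s M

lemma traceNorm_smul {c : ℝ} (hc : 0 ≤ c) (M : Matrix n n ℂ) :
    traceNorm (c • M) = c * traceNorm M := by
  apply le_antisymm
  · obtain ⟨W, hW, -, h⟩ := exists_contraction_trace_eq_traceNorm (c • M)
    rw [← h, Matrix.mul_smul, trace_smul, Complex.smul_re, smul_eq_mul]
    exact mul_le_mul_of_nonneg_left (re_trace_mul_le_traceNorm M hW) hc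
  · obtain ⟨W, hW, -, h⟩ := exists_contraction_trace_eq_traceNorm M
    rw [← h, ← smul_eq_mul, ← Complex.smul_re, ← trace_smul, ← Matrix.mul_smul]
    exact re_trace_mul_le_traceNorm _ hW

/-- Pinching does not increase the trace norm. -/
lemma sum_traceNorm_submatrix_le (e : o × m ≃ n) (N : Matrix n n ℂ) :
    ∑ k, traceNorm (N.submatrix (fun i => e (k, i)) (fun i => e (k, i))) ≤ traceNorm N := by
  choose W hW _ h using fun k => exists_contraction_trace_eq_traceNorm
    (N.submatrix (fun i => e (k, i)) (fun i => e (k, i)))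
  let f : m × o ≃ n := (Equiv.prodComm m o).trans e
  -- The optimal contractions of the single blocks assemble into one contraction; testing `N`
  -- against it picks out exactly the sum of the block norms.
  have hB : (1 - (blockDiagonal W).submatrix f.symm f.symm
      * ((blockDiagonal W).submatrix f.symm f.symm)ᴴ).PosSemidef := by
    choose S hS using fun k => (hW k).exists_eq_conjTranspose_mul_self
    have e1 : (1 : Matrix (m × o) (m × o) ℂ) - blockDiagonal W * (blockDiagonal W)ᴴ
        = (blockDiagonal S)ᴴ * blockDiagonal S := by
      rw [blockDiagonal_conjTranspose, blockDiagonal_conjTranspose, ← blockDiagonal_mul,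
        ← blockDiagonal_mul, ← blockDiagonal_one, ← blockDiagonal_sub]
      congr 1
      funext k
      exact hS k
    have e2 : (1 : Matrix n n ℂ) = (1 : Matrix (m × o) (m × o) ℂ).submatrix f.symm f.symm := by
      simp
    rw [conjTranspose_submatrix, submatrix_mul_equiv, e2]
    refine PosSemidef.submatrix (M := 1 - blockDiagonal W * (blockDiagonal W)ᴴ) ?_ _
    rw [e1]
    exact posSemidef_conjTranspose_mul_self _
  refine le_trans (le_of_eq ?_) (re_trace_mul_le_traceNorm N hB)
  simp_rw [← h, ← Complex.re_sum]
  congr 1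
  simp only [trace, diag, Matrix.mul_apply, submatrix_apply]
  rw [← f.sum_comp, Fintype.sum_prod_type_right]
  refine Finset.sum_congr rfl fun k _ => Finset.sum_congr rfl fun i _ => ?_
  rw [← f.sum_comp, Fintype.sum_prod_type_right, Finset.sum_eq_single k]
  · simp [blockDiagonal_apply, f]
  · intro k' _ hk
    simp [blockDiagonal_apply, hk.symm]
  · simp

/-- Cauchy–Schwarz for the Hilbert–Schmidt inner product, in its linearized form. -/
lemma two_mul_re_trace_mul_le (X Y : Matrix n n ℂ) {t : ℝ} (ht : 0 < t) :
    2 * (X * Y).trace.re ≤ t * (X * Xᴴ).trace.re + t⁻¹ * (Yᴴ * Y).trace.re := by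
  have key := (posSemidef_self_mul_conjTranspose (t • X - Yᴴ)).re_trace_nonneg
  have e : (t • X - Yᴴ) * (t • X - Yᴴ)ᴴ
      = (t * t) • (X * Xᴴ) - t • (X * Y) - t • (X * Y)ᴴ + Yᴴ * Y := by
    simp only [conjTranspose_sub, conjTranspose_smul, conjTranspose_conjTranspose, star_trivial,
      Matrix.sub_mul, Matrix.mul_sub, Matrix.smul_mul, Matrix.mul_smul, smul_sub, smul_smul,
      conjTranspose_mul]
    abel
  rw [e] at key
  simp only [trace_add, trace_sub, trace_smul, Complex.add_re, Complex.sub_re, Complex.smul_re,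
    smul_eq_mul, re_trace_conjTranspose] at key
  have h2 : 0 ≤ t⁻¹ * (t * t * (X * Xᴴ).trace.re - t * (X * Y).trace.re - t * (X * Y).trace.re
    + (Yᴴ * Y).trace.re) := mul_nonneg (inv_nonneg.2 ht.le) key
  have h3 : t⁻¹ * (t * t * (X * Xᴴ).trace.re - t * (X * Y).trace.re - t * (X * Y).trace.re
    + (Yᴴ * Y).trace.re) = t * (X * Xᴴ).trace.re - 2 * (X * Y).trace.re
      + t⁻¹ * (Yᴴ * Y).trace.re := by
    field_simp
    ring
  linarith

/-- A weighted Cauchy–Schwarz bound for the trace norm, in its linearized form. -/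
lemma two_mul_traceNorm_le {σ Z : Matrix n n ℂ} (hσ : σ.PosDef) (hZ : Z.IsHermitian) {t : ℝ}
    (ht : 0 < t) : 2 * traceNorm Z ≤ t * σ.trace.re + t⁻¹ * (Z * σ⁻¹ * Z).trace.re := by
  obtain ⟨W, -, hW, h⟩ := exists_contraction_trace_eq_traceNorm Z
  have hu : IsUnit σ.det := (isUnit_iff_isUnit_det σ).1 hσ.isUnit
  have hih : (σ⁻¹)ᴴ = σ⁻¹ := hσ.inv.isHermitian
  -- Complete the square in the `σ`-weighted inner product, with `W` the contraction attaining
  -- `‖Z‖₁`.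
  have key := (hσ.posSemidef.mul_mul_conjTranspose_same (t • W - Z * σ⁻¹)).re_trace_nonneg
  have e : (t • W - Z * σ⁻¹) * σ * (t • W - Z * σ⁻¹)ᴴ
      = (t * t) • (W * σ * Wᴴ) - t • (W * Z) - t • (W * Z)ᴴ + Z * σ⁻¹ * Z := by
    have e1 : (t • W - Z * σ⁻¹) * σ = t • (W * σ) - Z := by
      rw [Matrix.sub_mul, Matrix.mul_assoc Z, nonsing_inv_mul _ hu, Matrix.mul_one,
        Matrix.smul_mul]
    have e2 : W * σ * (σ⁻¹ * Z) = W * Z := by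
      rw [Matrix.mul_assoc, ← Matrix.mul_assoc σ, mul_nonsing_inv _ hu, Matrix.one_mul]
    rw [e1]
    simp only [conjTranspose_sub, conjTranspose_smul, star_trivial, conjTranspose_mul, hih, hZ.eq,
      Matrix.sub_mul, Matrix.mul_sub, Matrix.smul_mul, Matrix.mul_smul, smul_sub, smul_smul, e2]
    rw [Matrix.mul_assoc Z]
    abel
  rw [e] at key
  simp only [trace_add, trace_sub, trace_smul, Complex.add_re, Complex.sub_re, Complex.smul_re,
    smul_eq_mul, re_trace_conjTranspose, h] at key
  have h1 : (W * σ * Wᴴ).trace.re ≤ σ.trace.re := by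
    rw [trace_mul_comm, ← Matrix.mul_assoc, trace_mul_comm]
    exact hσ.posSemidef.re_trace_mul_le hW
  have h2 := mul_nonneg (inv_nonneg.2 ht.le) key
  have h3 : t⁻¹ * (t * t * (W * σ * Wᴴ).trace.re - t * traceNorm Z - t * traceNorm Z
    + (Z * σ⁻¹ * Z).trace.re) = t * (W * σ * Wᴴ).trace.re - 2 * traceNorm Z
      + t⁻¹ * (Z * σ⁻¹ * Z).trace.re := by
    field_simp
    ring
  nlinarith [mul_le_mul_of_nonneg_left h1 ht.le]

/-- If `0 ≤ R ≤ T` with `T` invertible, then `Tr (R T⁻¹ R) ≤ Tr R`. -/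
lemma re_trace_mul_inv_mul_le {R T : Matrix n n ℂ} (hT : T.PosDef) (hR : R.PosSemidef)
    (hRT : (T - R).PosSemidef) : (R * T⁻¹ * R).trace.re ≤ R.trace.re := by
  have hu : IsUnit T.det := (isUnit_iff_isUnit_det T).1 hT.isUnit
  have hih : (T⁻¹)ᴴ = T⁻¹ := hT.inv.isHermitian
  have hRh : Rᴴ = R := hR.isHermitian
  -- `R - R T⁻¹ R` is the sum of the two positive operators in `h1` and `h2`.
  have h1 := (hR.mul_mul_conjTranspose_same (1 - R * T⁻¹)).re_trace_nonneg
  have h2 := (hRT.mul_mul_conjTranspose_same (R * T⁻¹)).re_trace_nonneg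
  have e : (1 - R * T⁻¹) * R * (1 - R * T⁻¹)ᴴ + (R * T⁻¹) * (T - R) * (R * T⁻¹)ᴴ
      = R - R * T⁻¹ * R := by
    have e1 : R * T⁻¹ * T = R := by
      rw [Matrix.mul_assoc, nonsing_inv_mul _ hu, Matrix.mul_one]
    simp only [conjTranspose_sub, conjTranspose_one, conjTranspose_mul, hih, hRh,
      Matrix.sub_mul, Matrix.mul_sub, Matrix.one_mul, Matrix.mul_one, e1]
    simp only [Matrix.mul_assoc]
    abel
  have h3 := add_nonneg h1 h2
  rw [← Complex.add_re, ← trace_add, e, trace_sub, Complex.sub_re] at h3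
  linarith

/-- A Fuchs–van de Graaf type inequality. -/
lemma traceNorm_sub_le_of_purifiedDistance_le {ρ σ : Matrix n n ℂ} (hρ : IsState ρ)
    (hσ : IsState σ) {η : ℝ} (hη : 0 < η) (h : purifiedDistance ρ σ ≤ η) :
    traceNorm (ρ - σ) ≤ 2 * η ^ 2 + 3 * η := by
  set A := CFC.sqrt ρ with hA
  set B := CFC.sqrt σ with hB
  have hAA : A * A = ρ := CFC.sqrt_mul_sqrt_self ρ (nonneg_iff_posSemidef.2 hρ.1)
  have hBB : B * B = σ := CFC.sqrt_mul_sqrt_self σ (nonneg_iff_posSemidef.2 hσ.1)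
  have hAh : Aᴴ = A := (nonneg_iff_posSemidef.1 (CFC.sqrt_nonneg ρ)).isHermitian
  have hBh : Bᴴ = B := (nonneg_iff_posSemidef.1 (CFC.sqrt_nonneg σ)).isHermitian
  obtain ⟨W, hW, hW', hF⟩ := exists_contraction_trace_eq_traceNorm (A * B)
  have hF0 : 0 ≤ fidelity ρ σ := traceNorm_nonneg _
  -- For `F ≤ 1`, `1 - F ≤ (1 - F)(1 + F)`; for `F > 1` the left side is negative.
  have hF1 : 1 - fidelity ρ σ ≤ η ^ 2 := by
    unfold purifiedDistance at h
    have h1 : 1 - fidelity ρ σ ^ 2 ≤ η ^ 2 := (Real.sqrt_le_left hη.le).1 h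
    by_cases hF : fidelity ρ σ ≤ 1
    · nlinarith
    · nlinarith
  change (W * (A * B)).trace.re = fidelity ρ σ at hF
  set F := fidelity ρ σ
  -- `X = B W` and `A` have overlap `F`
  set X := B * W with hX
  have hXA : (X * A).trace.re = F := by
    rw [← hF, hX, Matrix.mul_assoc, trace_mul_comm, Matrix.mul_assoc]
  have hA1 : (A * Aᴴ).trace.re = 1 := by rw [hAh, hAA, hρ.2, Complex.one_re]
  have hXX : X * Xᴴ = B * (W * Wᴴ) * Bᴴ := by
    simp [hX, Matrix.mul_assoc]
  have hXpsd : (σ - X * Xᴴ).PosSemidef := by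
    have := hW.mul_mul_conjTranspose_same B
    rwa [Matrix.mul_sub, Matrix.sub_mul, Matrix.mul_one, ← hXX, hBh, hBB] at this
  have hx1 : (X * Xᴴ).trace.re ≤ 1 := by
    have := hXpsd.re_trace_nonneg
    rw [trace_sub, Complex.sub_re, hσ.2, Complex.one_re] at this
    linarith
  have hdiff : ((X - A) * (X - A)ᴴ).trace.re = (X * Xᴴ).trace.re + 1 - 2 * F := by
    have e : (X - A) * (X - A)ᴴ = X * Xᴴ - X * A - (X * A)ᴴ + A * Aᴴ := by
      simp only [conjTranspose_sub, Matrix.sub_mul, Matrix.mul_sub, conjTranspose_mul, hAh]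
      abel
    rw [e]
    simp only [trace_add, trace_sub, Complex.add_re, Complex.sub_re, re_trace_conjTranspose,
      hXA, hA1]
    ring
  have hdiff0 := (posSemidef_self_mul_conjTranspose (X - A)).re_trace_nonneg
  have hD2 : ((X - A) * (X - A)ᴴ).trace.re ≤ 2 * η ^ 2 := by linarith
  -- The first summand is positive with trace `1 - Tr (X Xᴴ) ≤ 2 - 2F`. The other two are linear in
  -- `X - A`, whose squared Hilbert–Schmidt norm is at most `2 η²`.
  have hsplit : σ - ρ = (σ - X * Xᴴ) + ((X - A) * Xᴴ + A * (X - A)ᴴ) := by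
    rw [← hAA]
    simp only [conjTranspose_sub, Matrix.sub_mul, Matrix.mul_sub, hAh]
    abel
  have h1 : traceNorm (σ - X * Xᴴ) ≤ 2 * η ^ 2 := by
    rw [traceNorm_of_posSemidef hXpsd, trace_sub, Complex.sub_re, hσ.2, Complex.one_re]
    linarith
  have h2 : traceNorm ((X - A) * Xᴴ + A * (X - A)ᴴ) ≤ 3 * η := by
    obtain ⟨V, hV, hV', h⟩ := exists_contraction_trace_eq_traceNorm ((X - A) * Xᴴ + A * (X - A)ᴴ)
    rw [← h, Matrix.mul_add, trace_add, Complex.add_re]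
    -- The weights `η⁻¹` and `η` balance the squared norms `2 η²` and `1`, so each product
    -- contributes at most `3 η / 2`.
    have a1 := two_mul_re_trace_mul_le (V * (X - A)) Xᴴ (inv_pos.2 hη)
    have a2 := two_mul_re_trace_mul_le (V * A) (X - A)ᴴ hη
    have b1 : ∀ Y : Matrix n n ℂ, (V * Y * (V * Y)ᴴ).trace.re ≤ (Y * Yᴴ).trace.re := by
      intro Y
      have e : V * Y * (V * Y)ᴴ = V * ((Y * Yᴴ) * Vᴴ) := by simp [Matrix.mul_assoc]
      rw [e, trace_mul_comm, Matrix.mul_assoc]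
      exact (posSemidef_self_mul_conjTranspose Y).re_trace_mul_le hV'
    rw [Matrix.mul_assoc, conjTranspose_conjTranspose, inv_inv] at a1
    rw [Matrix.mul_assoc, conjTranspose_conjTranspose] at a2
    have c1 : η⁻¹ * (V * (X - A) * (V * (X - A))ᴴ).trace.re ≤ η⁻¹ * (2 * η ^ 2) :=
      mul_le_mul_of_nonneg_left ((b1 _).trans hD2) (inv_nonneg.2 hη.le)
    have c2 : η * (V * A * (V * A)ᴴ).trace.re ≤ η * 1 :=
      mul_le_mul_of_nonneg_left ((b1 _).trans hA1.le) hη.le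
    have c3 : η⁻¹ * ((X - A) * (X - A)ᴴ).trace.re ≤ η⁻¹ * (2 * η ^ 2) :=
      mul_le_mul_of_nonneg_left hD2 (inv_nonneg.2 hη.le)
    have c4 : η * (X * Xᴴ).trace.re ≤ η * 1 := mul_le_mul_of_nonneg_left hx1 hη.le
    have c5 : η⁻¹ * (2 * η ^ 2) = 2 * η := by field_simp
    linarith
  rw [traceNorm_sub_comm, hsplit]
  exact (traceNorm_add_le _ _).trans (add_le_add h1 h2)

end TraceNormBounds

/-! ### Expectations over i.i.d. samples -/

section IidExpect

variable {α : Type*} [Fintype α] {P : α → ℝ} {K : ℕ}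

lemma iidExpect_mono (hP : P ∈ stdSimplex ℝ α) {g h : (Fin K → α) → ℝ} (hgh : ∀ a, g a ≤ h a) :
    iidExpect P K g ≤ iidExpect P K h :=
  Finset.sum_le_sum fun a _ =>
    mul_le_mul_of_nonneg_left (hgh a) (Finset.prod_nonneg fun i _ => hP.1 (a i))

lemma iidExpect_add (g h : (Fin K → α) → ℝ) :
    iidExpect P K (fun a => g a + h a) = iidExpect P K g + iidExpect P K h := by
  simp only [iidExpect, mul_add, Finset.sum_add_distrib]

lemma iidExpect_mul_left (c : ℝ) (g : (Fin K → α) → ℝ) :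
    iidExpect P K (fun a => c * g a) = c * iidExpect P K g := by
  simp only [iidExpect, Finset.mul_sum]
  exact Finset.sum_congr rfl fun _ _ => by ring

lemma iidExpect_sum {ι : Type*} (s : Finset ι) (g : ι → (Fin K → α) → ℝ) :
    iidExpect P K (fun a => ∑ i ∈ s, g i a) = ∑ i ∈ s, iidExpect P K (g i) := by
  simp only [iidExpect, Finset.mul_sum]
  exact Finset.sum_comm

/-- Peels off the first sample, which makes induction on the sample size possible. -/
lemma iidExpect_succ (g : (Fin (K + 1) → α) → ℝ) :
    iidExpect P (K + 1) g = ∑ x, P x * iidExpect P K (fun a => g (Fin.cons x a)) := by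
  unfold iidExpect
  rw [← (Fin.consEquiv fun _ : Fin (K + 1) => α).sum_comp, Fintype.sum_prod_type]
  refine Finset.sum_congr rfl fun x _ => ?_
  rw [Finset.mul_sum]
  refine Finset.sum_congr rfl fun a _ => ?_
  simp only [Fin.consEquiv_apply, Fin.prod_univ_succ, Fin.cons_zero, Fin.cons_succ]
  rw [mul_assoc]
  rfl

lemma iidExpect_const (hP : P ∈ stdSimplex ℝ α) (c : ℝ) : iidExpect P K (fun _ => c) = c := by
  induction K with
  | zero => simp [iidExpect]
  | succ K ih => rw [iidExpect_succ]; simp only [ih]; rw [← Finset.sum_mul, hP.2, one_mul]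

lemma iidExpect_eval (hP : P ∈ stdSimplex ℝ α) (g : α → ℝ) (i : Fin K) :
    iidExpect P K (fun a => g (a i)) = ∑ x, P x * g x := by
  induction K with
  | zero => exact i.elim0
  | succ K ih =>
    rw [iidExpect_succ]
    refine Fin.cases ?_ (fun j => ?_) i
    · simp only [Fin.cons_zero, iidExpect_const hP]
    · simp only [Fin.cons_succ, ih j]
      rw [← Finset.sum_mul, hP.2, one_mul]

/-- Every sample has law `P`; this turns errors averaged over sampled letters into `P`-averages. -/
lemma iidExpect_avg_eval (hP : P ∈ stdSimplex ℝ α) (hK : 0 < K) (g : α → ℝ) :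
    iidExpect P K (fun a => (K : ℝ)⁻¹ * ∑ i, g (a i)) = ∑ x, P x * g x := by
  have hK' : (K : ℝ) ≠ 0 := Nat.cast_ne_zero.2 hK.ne'
  rw [iidExpect_mul_left, iidExpect_sum]
  simp only [iidExpect_eval hP, Finset.sum_const, Finset.card_univ, Fintype.card_fin, nsmul_eq_mul]
  rw [← mul_assoc, inv_mul_cancel₀ hK', one_mul]

/-- The second moment of a sum of i.i.d. centred vectors. -/
lemma iidExpect_bilin_sum {M : Type*} [AddCommGroup M] [Module ℝ M] (hP : P ∈ stdSimplex ℝ α)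
    (B : M →ₗ[ℝ] M →ₗ[ℝ] ℝ) (x : α → M) (hx : ∑ a, P a • x a = 0) :
    iidExpect P K (fun a => B (∑ i, x (a i)) (∑ i, x (a i))) = K * ∑ a, P a * B (x a) (x a) := by
  induction K with
  | zero => simp [iidExpect]
  | succ K ih =>
    -- Centring makes the cross terms vanish on either side, so each new sample adds one diagonal
    -- term.
    have h1 : ∀ s, ∑ a, P a * B (x a) s = 0 := fun s => by
      have := congrArg (fun y => B y s) hx
      simpa using this
    have h2 : ∀ s, ∑ a, P a * B s (x a) = 0 := fun s => by
      have := congrArg (fun y => B s y) hx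
      simpa using this
    have e : ∀ s, ∑ a, P a * B (x a + s) (x a + s) = ∑ a, P a * B (x a) (x a) + B s s := by
      intro s
      simp only [map_add, LinearMap.add_apply, mul_add, Finset.sum_add_distrib, h1, h2]
      rw [← Finset.sum_mul, hP.2]
      ring
    rw [iidExpect_succ]
    simp only [Fin.sum_univ_succ, Fin.cons_zero, Fin.cons_succ, ← iidExpect_mul_left]
    rw [← iidExpect_sum]
    simp only [e]
    rw [iidExpect_add, iidExpect_const hP, ih]
    push_cast
    ring

end IidExpect

/-! ### One-shot covering for classical-quantum states -/

section Covering

open Matrix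

variable {A B n : Type*} [Fintype A] [DecidableEq A] [Fintype B] [DecidableEq B]
  [Fintype n] [DecidableEq n]

/-- The real bilinear form `(Y, Z) ↦ Re Tr (Y T Z)`. -/
noncomputable def reTraceForm (T : Matrix n n ℂ) :
    Matrix n n ℂ →ₗ[ℝ] Matrix n n ℂ →ₗ[ℝ] ℝ :=
  LinearMap.mk₂ ℝ (fun Y Z => (Y * T * Z).trace.re)
    (fun _ _ _ => by simp [Matrix.add_mul])
    (fun _ _ _ => by simp)
    (fun _ _ _ => by simp [Matrix.mul_add])
    (fun _ _ _ => by simp)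

lemma reTraceForm_apply (T Y Z : Matrix n n ℂ) : reTraceForm T Y Z = (Y * T * Z).trace.re := rfl

/-- The sample average of operators dominated by `T` is close to the mean. -/
lemma two_mul_iidExpect_traceNorm_le {P : A → ℝ} (hP : P ∈ stdSimplex ℝ A) {K : ℕ} (hK : 0 < K)
    {R : A → Matrix n n ℂ} (hR : ∀ a, (R a).PosSemidef) {T : Matrix n n ℂ} (hT : T.PosDef)
    (hRT : ∀ a, (T - R a).PosSemidef) (htr : ∑ a, P a * (R a).trace.re ≤ 1) {s : ℝ} (hs : 0 < s) :
    2 * iidExpect P K (fun a => traceNorm ((K : ℝ)⁻¹ • ∑ i, R (a i) - ∑ a, P a • R a))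
      ≤ s * T.trace.re + s⁻¹ * (K : ℝ)⁻¹ := by
  have hK' : (K : ℝ) ≠ 0 := Nat.cast_ne_zero.2 hK.ne'
  set m := ∑ a, P a • R a with hm
  set Q := reTraceForm T⁻¹ with hQ
  have hmh : mᴴ = m := by
    rw [hm, conjTranspose_sum]
    refine Finset.sum_congr rfl fun a _ => ?_
    rw [conjTranspose_smul, star_trivial, (hR a).isHermitian.eq]
  have hZ : ∀ a : Fin K → A, (K : ℝ)⁻¹ • ∑ i, R (a i) - m = (K : ℝ)⁻¹ • ∑ i, (R (a i) - m) := by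
    intro a
    rw [Finset.sum_sub_distrib, smul_sub]
    simp only [Finset.sum_const, Finset.card_univ, Fintype.card_fin]
    rw [← Nat.cast_smul_eq_nsmul ℝ, smul_smul, inv_mul_cancel₀ hK', one_smul]
  -- Weighted Cauchy–Schwarz for each sample; the form `Q` with kernel `T⁻¹` makes the remaining
  -- term bilinear in a sum of centred vectors.
  have hpt : ∀ a : Fin K → A, 2 * traceNorm ((K : ℝ)⁻¹ • ∑ i, R (a i) - m)
      ≤ s * T.trace.re + s⁻¹ * ((K : ℝ)⁻¹ * (K : ℝ)⁻¹)
        * Q (∑ i, (R (a i) - m)) (∑ i, (R (a i) - m)) := by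
    intro a
    have hh : ((K : ℝ)⁻¹ • ∑ i, (R (a i) - m)).IsHermitian := by
      unfold IsHermitian
      rw [conjTranspose_smul, star_trivial, conjTranspose_sum]
      congr 1
      exact Finset.sum_congr rfl fun i _ => by
        rw [conjTranspose_sub, (hR (a i)).isHermitian.eq, hmh]
    rw [hZ]
    refine (two_mul_traceNorm_le hT hh hs).trans (le_of_eq ?_)
    rw [← reTraceForm_apply, map_smul, map_smul, LinearMap.smul_apply, smul_eq_mul, smul_eq_mul]
    ring
  -- The variance is at most the second moment because `Q m m ≥ 0`; domination by `T` then bounds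
  -- the second moment by the mean trace.
  have hvar : ∑ a, P a * Q (R a - m) (R a - m) ≤ 1 := by
    have e : ∑ a, P a * Q (R a - m) (R a - m) = ∑ a, P a * Q (R a) (R a) - Q m m := by
      have e1 : ∑ a, P a * Q (R a) m = Q m m :=
        calc ∑ a, P a * Q (R a) m = Q (∑ a, P a • R a) m := by simp
          _ = Q m m := by rw [← hm]
      have e2 : ∑ a, P a * Q m (R a) = Q m m :=
        calc ∑ a, P a * Q m (R a) = Q m (∑ a, P a • R a) := by simp
          _ = Q m m := by rw [← hm]
      simp only [map_sub, LinearMap.sub_apply, mul_sub, Finset.sum_sub_distrib, e1, e2]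
      rw [← Finset.sum_mul, hP.2]
      ring
    have hm0 : 0 ≤ Q m m := by
      have := (hT.inv.posSemidef.mul_mul_conjTranspose_same m).re_trace_nonneg
      rwa [hmh] at this
    have hle : ∑ a, P a * Q (R a) (R a) ≤ ∑ a, P a * (R a).trace.re :=
      Finset.sum_le_sum fun a _ =>
        mul_le_mul_of_nonneg_left (re_trace_mul_inv_mul_le hT (hR a) (hRT a)) (hP.1 a)
    linarith
  have hx0 : ∑ a, P a • (R a - m) = 0 := by
    simp only [smul_sub, Finset.sum_sub_distrib]
    rw [← Finset.sum_smul, hP.2, one_smul, ← hm, sub_self]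
  rw [← iidExpect_mul_left]
  refine (iidExpect_mono hP hpt).trans ?_
  rw [iidExpect_add, iidExpect_const hP, iidExpect_mul_left, iidExpect_bilin_sum hP Q _ hx0]
  refine add_le_add le_rfl ?_
  have hc : 0 ≤ s⁻¹ * (K : ℝ)⁻¹ := by positivity
  calc s⁻¹ * ((K : ℝ)⁻¹ * (K : ℝ)⁻¹) * (K * ∑ a, P a * Q (R a - m) (R a - m))
      = s⁻¹ * (K : ℝ)⁻¹ * ∑ a, P a * Q (R a - m) (R a - m) := by field_simp
    _ ≤ s⁻¹ * (K : ℝ)⁻¹ * 1 := mul_le_mul_of_nonneg_left hvar hc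
    _ = s⁻¹ * (K : ℝ)⁻¹ := mul_one _

/-- The classical-quantum state `∑ P(a) |a⟩⟨a| ⊗ r_a`. -/
noncomputable def cqState (P : A → ℝ) (r : A → Matrix B B ℂ) : Matrix (A × B) (A × B) ℂ :=
  ∑ a, P a • (ketbra a ⊗ₖ r a)

lemma cqState_apply (P : A → ℝ) (r : A → Matrix B B ℂ) (i j : A × B) :
    cqState P r i j = if i.1 = j.1 then P i.1 * r i.1 i.2 j.2 else 0 := by
  simp only [cqState, Matrix.sum_apply, Matrix.smul_apply, kroneckerMap_apply, ketbra,
    single_apply, Complex.real_smul]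
  rw [Finset.sum_eq_single i.1]
  · by_cases h : i.1 = j.1 <;> simp [h]
  · intro a _ ha
    simp [ha]
  · simp

lemma cqState_submatrix (P : A → ℝ) (r : A → Matrix B B ℂ) (a : A) :
    (cqState P r).submatrix (fun b => (a, b)) (fun b => (a, b)) = P a • r a := by
  ext b b'
  simp [cqState_apply]

/-- Compressing an operator inequality against the product of the marginals to the letter `a` thus
yields a bound by `P a` times the mean state. -/
lemma cqState_marginals_submatrix (P : A → ℝ) {r : A → Matrix B B ℂ} (hr : ∀ a, IsState (r a))
    (a : A) : (traceRight (cqState P r) ⊗ₖ traceLeft (cqState P r)).submatrix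
      (fun b => (a, b)) (fun b => (a, b)) = P a • ∑ a, P a • r a := by
  have h1 : traceRight (cqState P r) a a = P a := by
    have := (hr a).2
    simp only [trace, diag] at this
    simp only [traceRight, of_apply, cqState_apply, if_true]
    rw [← Finset.mul_sum, this, mul_one]
  ext b b'
  simp only [submatrix_apply, kronecker_apply, h1]
  simp [traceLeft, cqState_apply, Matrix.sum_apply]

lemma isState_sum_smul {P : A → ℝ} (hP : P ∈ stdSimplex ℝ A) {r : A → Matrix B B ℂ}
    (hr : ∀ a, IsState (r a)) : IsState (∑ a, P a • r a) := by
  refine ⟨posSemidef_sum _ fun a _ => (hr a).1.smul (hP.1 a), ?_⟩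
  simp only [trace_sum, trace_smul, (hr _).2]
  rw [← Finset.sum_smul, hP.2, one_smul]

/-- One-shot covering: if `log K` exceeds the smooth max mutual information of a
classical-quantum state by `log (2 / δ³)`, then the average of `K` samples is close to the mean. -/
theorem iidExpect_traceNorm_le_of_smoothImax_add_le {P : A → ℝ} (hP : P ∈ stdSimplex ℝ A)
    {r : A → Matrix B B ℂ} (hr : ∀ a, IsState (r a)) {η δ g : ℝ} (hη : 0 < η) (hηδ : η ≤ δ)
    (hδ : δ < 1) {K : ℕ} (hK : 0 < K) (hg : Real.logb 2 (2 / δ ^ 3) ≤ g)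
    (h : smoothImax η (cqState P r) + (g : EReal) ≤ ((Real.logb 2 K : ℝ) : EReal)) :
    iidExpect P K (fun a => traceNorm ((K : ℝ)⁻¹ • ∑ i, r (a i) - ∑ a, P a • r a)) ≤ 12 * δ := by
  have hδ0 : 0 < δ := hη.trans_le hηδ
  have hKp : (0 : ℝ) < K := Nat.cast_pos.2 hK
  -- The infima need not be attained, so one bit of slack is allowed; the factor `2` in `2 / δ ^ 3`
  -- pays for it, giving `L ≤ K δ³`.
  obtain ⟨τ, hτ, hητ, l, hl, hlK⟩ : ∃ τ : Matrix (A × B) (A × B) ℂ, IsState τ ∧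
      purifiedDistance τ (cqState P r) ≤ η ∧ ∃ l : ℝ, τ ≤ ((2 : ℝ) ^ l) •
        (traceRight (cqState P r) ⊗ₖ traceLeft (cqState P r)) ∧ l < Real.logb 2 K - g + 1 := by
    have h1 : smoothImax η (cqState P r) < ((Real.logb 2 K - g + 1 : ℝ) : EReal) := by
      have h2 : smoothImax η (cqState P r) ≤ ((Real.logb 2 K : ℝ) : EReal) - (g : EReal) :=
        (EReal.le_sub_iff_add_le (Or.inl (EReal.coe_ne_bot _)) (Or.inl (EReal.coe_ne_top _))).2 h
      refine h2.trans_lt ?_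
      rw [← EReal.coe_sub, EReal.coe_lt_coe_iff]
      linarith
    unfold smoothImax smoothDmax Dmax at h1
    simp only [iInf_lt_iff] at h1
    obtain ⟨τ, ⟨hτ, hητ⟩, l, hl, hlK⟩ := h1
    exact ⟨τ, hτ, hητ, l, hl, EReal.coe_lt_coe_iff.1 hlK⟩
  set L : ℝ := 2 ^ l with hL
  have hL0 : 0 < L := Real.rpow_pos_of_pos two_pos l
  have hLK : L ≤ K * δ ^ 3 := by
    have h1 : l ≤ Real.logb 2 (K * δ ^ 3) := by
      rw [Real.logb_div (by norm_num) (by positivity), Real.logb_self_eq_one (by norm_num)] at hg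
      rw [Real.logb_mul hKp.ne' (by positivity)]
      linarith
    exact (Real.le_logb_iff_rpow_le (by norm_num) (by positivity)).1 h1
  set σ := ∑ a, P a • r a with hσ
  have hσs : IsState σ := isState_sum_smul hP hr
  set b : A → Matrix B B ℂ := fun a => τ.submatrix (fun b => (a, b)) (fun b => (a, b)) with hb
  -- The conditional operators of `τ`, normalised by the weights of the original state. Letters of
  -- weight zero get `R a = 0`.
  set R : A → Matrix B B ℂ := fun a => (P a)⁻¹ • b a with hRdef
  have hbpsd : ∀ a, (b a).PosSemidef := fun a => hτ.1.submatrix _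
  have hR : ∀ a, (R a).PosSemidef := fun a => (hbpsd a).smul (inv_nonneg.2 (hP.1 a))
  have hble : ∀ a, ((L * P a) • σ - b a).PosSemidef := by
    intro a
    have h1 := (Matrix.le_iff.1 hl).submatrix (fun b : B => (a, b))
    have e : (L • (traceRight (cqState P r) ⊗ₖ traceLeft (cqState P r)) - τ).submatrix
        (fun b : B => (a, b)) (fun b => (a, b)) = (L * P a) • σ - b a := by
      rw [mul_smul, ← cqState_marginals_submatrix P hr a]
      rfl
    rwa [e] at h1
  have hRσ : ∀ a, (L • σ - R a).PosSemidef := by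
    intro a
    by_cases ha : P a = 0
    · simp only [hRdef, ha, _root_.inv_zero, zero_smul, sub_zero]
      exact hσs.1.smul hL0.le
    · have e : L • σ - R a = (P a)⁻¹ • ((L * P a) • σ - b a) := by
        rw [smul_sub, smul_smul]
        congr 2
        field_simp
      rw [e]
      exact (hble a).smul (inv_nonneg.2 (hP.1 a))
  have htrb : ∑ a, (b a).trace.re = 1 := by
    have h1 := congrArg Complex.re hτ.2
    rw [trace, Fintype.sum_prod_type, Complex.re_sum, Complex.one_re] at h1
    exact h1
  have htr : ∑ a, P a * (R a).trace.re ≤ 1 := by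
    rw [← htrb]
    refine Finset.sum_le_sum fun a _ => ?_
    by_cases ha : P a = 0
    · rw [ha, zero_mul]
      exact (hbpsd a).re_trace_nonneg
    · simp only [hRdef, trace_smul, Complex.smul_re, smul_eq_mul]
      rw [← mul_assoc, mul_inv_cancel₀ ha, one_mul]
  -- Pinching reduces this to `‖τ - cqState P r‖₁ ≤ 2 η² + 3 η`, and `η ≤ δ < 1`.
  have hdist : ∑ a, P a * traceNorm (r a - R a) ≤ 5 * δ := by
    have h0 : IsState (cqState P r) := by
      refine ⟨posSemidef_sum _ fun a _ => PosSemidef.smul (PosSemidef.kronecker ?_ (hr a).1)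
        (hP.1 a), ?_⟩
      · have : ketbra a = (ketbra a)ᴴ * ketbra a := by simp [ketbra]
        rw [this]
        exact posSemidef_conjTranspose_mul_self _
      · rw [cqState, trace_sum]
        simp only [trace_smul, trace_kronecker, (hr _).2]
        simp only [ketbra, trace_single_eq_same, mul_one]
        rw [← Finset.sum_smul, hP.2, one_smul]
    have h1 := traceNorm_sub_le_of_purifiedDistance_le hτ h0 hη hητ
    have h2 := sum_traceNorm_submatrix_le (Equiv.refl (A × B)) (cqState P r - τ)
    rw [traceNorm_sub_comm] at h2
    have h3 : ∑ a, P a * traceNorm (r a - R a) ≤ traceNorm (τ - cqState P r) := by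
      refine (Finset.sum_le_sum fun a _ => ?_).trans h2
      by_cases ha : P a = 0
      · rw [ha, zero_mul]
        exact traceNorm_nonneg _
      · refine le_of_eq ?_
        rw [← traceNorm_smul (hP.1 a)]
        congr 1
        rw [smul_sub, ← cqState_submatrix, hRdef, smul_smul, mul_inv_cancel₀ ha, one_smul]
        rfl
    nlinarith
  -- the dominating operator is made invertible
  have hne : Nonempty B := by
    by_contra hB
    rw [not_nonempty_iff] at hB
    have := hσs.2
    simp [trace] at this
  have hd : (0 : ℝ) < Fintype.card B := Nat.cast_pos.2 Fintype.card_pos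
  -- The multiple of the identity has trace `L`, so it only doubles the trace.
  set T : Matrix B B ℂ := L • σ + (L * (Fintype.card B : ℝ)⁻¹) • (1 : Matrix B B ℂ) with hT
  have hc : 0 < L * (Fintype.card B : ℝ)⁻¹ := by positivity
  have hTP : T.PosDef := PosDef.posSemidef_add (hσs.1.smul hL0.le) (PosDef.one.smul hc)
  have hRT : ∀ a, (T - R a).PosSemidef := by
    intro a
    have e : T - R a = (L • σ - R a) + (L * (Fintype.card B : ℝ)⁻¹) • (1 : Matrix B B ℂ) := by
      rw [hT]; abel
    rw [e]
    exact (hRσ a).add (PosDef.one.smul hc).posSemidef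
  have hTtr : T.trace.re = 2 * L := by
    rw [hT, trace_add, trace_smul, trace_smul, trace_one, hσs.2]
    simp only [Complex.add_re, Complex.smul_re, Complex.one_re, Complex.natCast_re, smul_eq_mul]
    field_simp
    norm_num
  -- With this `s` the variance term is exactly `δ`, and the trace term `2 L / (K δ)` is at most `2
  -- δ²`.
  have hcov := two_mul_iidExpect_traceNorm_le hP hK hR hTP hRT htr
    (s := (K * δ)⁻¹) (by positivity)
  have hcov' : iidExpect P K (fun a => traceNorm ((K : ℝ)⁻¹ • ∑ i, R (a i) - ∑ a, P a • R a))
      ≤ 2 * δ := by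
    have e1 : (K * δ)⁻¹ * T.trace.re ≤ 2 * δ := by
      rw [hTtr, inv_mul_le_iff₀ (by positivity)]
      have : K * δ ^ 3 ≤ K * δ ^ 2 := by
        apply mul_le_mul_of_nonneg_left _ hKp.le
        exact pow_le_pow_of_le_one hδ0.le hδ.le (by norm_num)
      nlinarith
    have e2 : ((K * δ)⁻¹)⁻¹ * (K : ℝ)⁻¹ = δ := by field_simp
    rw [e2] at hcov
    linarith
  -- Replacing `r` by `R` costs `5 δ` in the sample average and `5 δ` in the mean; with `2 δ` for
  -- the fluctuation this makes `12 δ`.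
  have hpt : ∀ a : Fin K → A, traceNorm ((K : ℝ)⁻¹ • ∑ i, r (a i) - σ)
      ≤ ((K : ℝ)⁻¹ * ∑ i, traceNorm (r (a i) - R (a i))
          + traceNorm ((K : ℝ)⁻¹ • ∑ i, R (a i) - ∑ a, P a • R a))
        + ∑ a, P a * traceNorm (r a - R a) := by
    intro a
    have e : (K : ℝ)⁻¹ • ∑ i, r (a i) - σ = ((K : ℝ)⁻¹ • ∑ i, (r (a i) - R (a i))
        + ((K : ℝ)⁻¹ • ∑ i, R (a i) - ∑ a, P a • R a)) - ∑ a, P a • (r a - R a) := by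
      simp only [Finset.sum_sub_distrib, smul_sub, hσ]
      abel
    rw [e]
    refine (traceNorm_sub_le _ _).trans (add_le_add ((traceNorm_add_le _ _).trans ?_) ?_)
    · rw [traceNorm_smul (inv_nonneg.2 hKp.le)]
      gcongr
      exact traceNorm_sum_le _ _
    · refine (traceNorm_sum_le _ _).trans (le_of_eq ?_)
      exact Finset.sum_congr rfl fun a _ => traceNorm_smul (hP.1 a) _
  refine (iidExpect_mono hP hpt).trans ?_
  rw [iidExpect_add, iidExpect_add, iidExpect_const hP,
    iidExpect_avg_eval hP hK (fun a => traceNorm (r a - R a))]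
  linarith

end Covering

/-! ### Covering with classical side information -/

section ConditionalCovering

open Matrix

variable {A B Z n : Type*} [Fintype A] [DecidableEq A] [Fintype B] [DecidableEq B]
  [Fintype Z] [DecidableEq Z] [Fintype n] [DecidableEq n]

lemma Matrix.PosSemidef.blockDiagonal {D : Z → Matrix n n ℂ} (hD : ∀ z, (D z).PosSemidef) :
    (Matrix.blockDiagonal D).PosSemidef := by
  choose S hS using fun z => (hD z).exists_eq_conjTranspose_mul_self
  have e : Matrix.blockDiagonal D = (Matrix.blockDiagonal S)ᴴ * Matrix.blockDiagonal S := by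
    rw [blockDiagonal_conjTranspose, ← blockDiagonal_mul]
    congr 1
    funext z
    exact hS z
  rw [e]
  exact posSemidef_conjTranspose_mul_self _

lemma isState_blockDiagonal {w : Z → ℝ} (hw : w ∈ stdSimplex ℝ Z) {r : Z → Matrix n n ℂ}
    (hr : ∀ z, IsState (r z)) : IsState (blockDiagonal fun z => w z • r z) := by
  refine ⟨PosSemidef.blockDiagonal fun z => (hr z).1.smul (hw.1 z), ?_⟩
  rw [trace_blockDiagonal]
  simp only [trace_smul, (hr _).2]
  rw [← Finset.sum_smul, hw.2, one_smul]

/-- Pinching to the blocks; this lets one trace norm control the average over the side information.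
-/
lemma sum_mul_traceNorm_le_blockDiagonal {w : Z → ℝ} (hw : w ∈ stdSimplex ℝ Z)
    (M : Z → Matrix n n ℂ) :
    ∑ z, w z * traceNorm (M z) ≤ traceNorm (blockDiagonal fun z => w z • M z) := by
  refine le_trans (le_of_eq ?_) (sum_traceNorm_submatrix_le (Equiv.prodComm Z n) _)
  refine Finset.sum_congr rfl fun z _ => ?_
  rw [← traceNorm_smul (hw.1 z)]
  congr 1
  ext i j
  simp [blockDiagonal_apply]

/-- Covering conditioned on classical side information `Z`. -/
theorem sum_mul_iidExpect_traceNorm_le_of_smoothImax_add_le {P : A → ℝ} (hP : P ∈ stdSimplex ℝ A)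
    {w : Z → ℝ} (hw : w ∈ stdSimplex ℝ Z) {r : A → Z → Matrix n n ℂ}
    (hr : ∀ a z, IsState (r a z)) {η δ g : ℝ} (hη : 0 < η) (hηδ : η ≤ δ)
    (hδ : δ < 1) {K : ℕ} (hK : 0 < K) (hg : Real.logb 2 (2 / δ ^ 3) ≤ g)
    (h : smoothImax η (cqState P fun a => blockDiagonal fun z => w z • r a z) + (g : EReal)
      ≤ ((Real.logb 2 K : ℝ) : EReal)) :
    ∑ z, w z * iidExpect P K (fun a =>
      traceNorm ((K : ℝ)⁻¹ • ∑ i, r (a i) z - ∑ a, P a • r a z)) ≤ 12 * δ := by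
  have h1 := iidExpect_traceNorm_le_of_smoothImax_add_le hP
    (fun a => isState_blockDiagonal hw (hr a)) hη hηδ hδ hK hg h
  refine le_trans ?_ h1
  simp only [← iidExpect_mul_left]
  rw [← iidExpect_sum]
  refine iidExpect_mono hP fun a => ?_
  -- The same samples serve all `z`, and averaging commutes with forming block diagonals.
  refine (sum_mul_traceNorm_le_blockDiagonal hw _).trans (le_of_eq ?_)
  congr 1
  ext ⟨i, z⟩ ⟨j, z'⟩
  by_cases hz : z = z'
  · subst hz
    simp [blockDiagonal_apply, Matrix.sum_apply, mul_sub, Finset.mul_sum, mul_left_comm]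
  · simp [blockDiagonal_apply, Matrix.sum_apply, hz]

end ConditionalCovering

/-! ### Telescoping over the three samples -/

section ThreeSamples

open Matrix

variable {U Y V n : Type*} [Fintype U] [Fintype Y] [Fintype V] [Fintype n] [DecidableEq n]

/-- The deviation of a triple sample average from the mean, bounded by sampling one variable at a
time. -/
lemma iidExpect_three_traceNorm_le {PU : U → ℝ} (hPU : PU ∈ stdSimplex ℝ U) {PY : Y → ℝ}
    (hPY : PY ∈ stdSimplex ℝ Y) {PV : V → ℝ} (hPV : PV ∈ stdSimplex ℝ V)
    {K₁ K₂ K₃ : ℕ} (h₁ : 0 < K₁) (h₂ : 0 < K₂) (s : U → Y → V → Matrix n n ℂ) :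
    iidExpect PU K₁ (fun u => iidExpect PY K₂ (fun y => iidExpect PV K₃ (fun v =>
      traceNorm ((1 / ((K₁ : ℝ) * K₂ * K₃)) • (∑ i, ∑ j, ∑ k, s (u i) (y j) (v k))
        - ∑ u, PU u • ∑ y, PY y • ∑ v, PV v • s u y v))))
    ≤ ∑ u, PU u * ∑ y, PY y * iidExpect PV K₃ (fun v =>
        traceNorm ((K₃ : ℝ)⁻¹ • ∑ k, s u y (v k) - ∑ v, PV v • s u y v))
      + ∑ u, PU u * iidExpect PY K₂ (fun y => traceNorm ((K₂ : ℝ)⁻¹ • ∑ j, ∑ v, PV v • s u (y j) v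
        - ∑ y, PY y • ∑ v, PV v • s u y v))
      + iidExpect PU K₁ (fun u => traceNorm ((K₁ : ℝ)⁻¹ • ∑ i, ∑ y, PY y • ∑ v, PV v • s (u i) y v
        - ∑ u, PU u • ∑ y, PY y • ∑ v, PV v • s u y v)) := by
  set m2 : U → Y → Matrix n n ℂ := fun u y => ∑ v, PV v • s u y v
  set m1 : U → Matrix n n ℂ := fun u => ∑ y, PY y • m2 u y
  set m0 : Matrix n n ℂ := ∑ u, PU u • m1 u
  have hpt : ∀ (u : Fin K₁ → U) (y : Fin K₂ → Y) (v : Fin K₃ → V),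
      traceNorm ((1 / ((K₁ : ℝ) * K₂ * K₃)) • (∑ i, ∑ j, ∑ k, s (u i) (y j) (v k)) - m0)
      ≤ (K₁ : ℝ)⁻¹ * ∑ i, (K₂ : ℝ)⁻¹ * ∑ j,
          traceNorm ((K₃ : ℝ)⁻¹ • ∑ k, s (u i) (y j) (v k) - m2 (u i) (y j))
        + (K₁ : ℝ)⁻¹ * ∑ i, traceNorm ((K₂ : ℝ)⁻¹ • ∑ j, m2 (u i) (y j) - m1 (u i))
        + traceNorm ((K₁ : ℝ)⁻¹ • ∑ i, m1 (u i) - m0) := by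
    intro u y v
    -- Insert and remove the partial means `m2` and `m1`.
    have e : (1 / ((K₁ : ℝ) * K₂ * K₃)) • (∑ i, ∑ j, ∑ k, s (u i) (y j) (v k)) - m0
        = (K₁ : ℝ)⁻¹ • ∑ i, (K₂ : ℝ)⁻¹ • ∑ j,
            ((K₃ : ℝ)⁻¹ • ∑ k, s (u i) (y j) (v k) - m2 (u i) (y j))
          + (K₁ : ℝ)⁻¹ • ∑ i, ((K₂ : ℝ)⁻¹ • ∑ j, m2 (u i) (y j) - m1 (u i))
          + ((K₁ : ℝ)⁻¹ • ∑ i, m1 (u i) - m0) := by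
      simp only [Finset.sum_sub_distrib, smul_sub, ← Finset.smul_sum, smul_smul]
      rw [one_div, mul_inv, mul_inv, mul_assoc]
      abel
    rw [e]
    have n1 : (0 : ℝ) ≤ (K₁ : ℝ)⁻¹ := by positivity
    have n2 : (0 : ℝ) ≤ (K₂ : ℝ)⁻¹ := by positivity
    refine (traceNorm_add_le _ _).trans (add_le_add ((traceNorm_add_le _ _).trans
      (add_le_add ?_ ?_)) le_rfl)
    · rw [traceNorm_smul n1]
      refine mul_le_mul_of_nonneg_left ((traceNorm_sum_le _ _).trans
        (Finset.sum_le_sum fun i _ => ?_)) n1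
      rw [traceNorm_smul n2]
      exact mul_le_mul_of_nonneg_left (traceNorm_sum_le _ _) n2
    · rw [traceNorm_smul n1]
      exact mul_le_mul_of_nonneg_left (traceNorm_sum_le _ _) n1
  refine (iidExpect_mono hPU fun u => iidExpect_mono hPY fun y => iidExpect_mono hPV fun v =>
    hpt u y v).trans (le_of_eq ?_)
  simp only [iidExpect_add, iidExpect_const hPV, iidExpect_const hPY]
  congr 1
  congr 1
  · rw [← iidExpect_avg_eval hPU h₁]
    refine congrArg _ (funext fun u => ?_)
    simp only [iidExpect_mul_left, iidExpect_sum]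
    congr 1
    refine Finset.sum_congr rfl fun i _ => ?_
    rw [← iidExpect_avg_eval hPY h₂]
    simp only [iidExpect_mul_left, iidExpect_sum]
    rfl
  · rw [← iidExpect_avg_eval hPU h₁]
    refine congrArg _ (funext fun u => ?_)
    simp only [iidExpect_mul_left, iidExpect_sum]
    rfl

end ThreeSamples

/-! ### Marginals of the control states -/

section Marginals

open Matrix

variable {X Y C E : Type*} [Fintype X] [DecidableEq X] [Fintype Y] [DecidableEq Y]
  [Fintype C] [DecidableEq C] [Fintype E] [DecidableEq E]

lemma IsState.traceLeft {ρ : Matrix (C × E) (C × E) ℂ} (hρ : IsState ρ) :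
    IsState (traceLeft ρ) := by
  have e : _root_.traceLeft ρ = ∑ c, ρ.submatrix (fun e => (c, e)) (fun e => (c, e)) := by
    ext i j
    simp [_root_.traceLeft, Matrix.sum_apply]
  refine ⟨?_, ?_⟩
  · rw [e]
    exact posSemidef_sum _ fun c _ => hρ.1.submatrix _
  · rw [← hρ.2]
    simp only [trace, diag, _root_.traceLeft, of_apply]
    rw [Fintype.sum_prod_type, Finset.sum_comm]

lemma rateSplitState_apply (PU PV : X → ℝ) (f : X → X → X) (PY : Y → ℝ)
    (ρ : X → Y → Matrix (C × E) (C × E) ℂ) (u u' v v' : X) (y y' : Y) (c c' : C) (e e' : E) :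
    rateSplitState PU PV f PY ρ (u, v, y, c, e) (u', v', y', c', e')
      = if u = u' then if v = v' then if y = y' then
          ((PU u * PV v * PY y : ℝ) : ℂ) * ρ (f u v) y (c, e) (c', e') else 0 else 0 else 0 := by
  simp only [rateSplitState, Matrix.sum_apply, Matrix.smul_apply, kroneckerMap_apply, ketbra,
    single_apply, Complex.real_smul]
  rw [Finset.sum_eq_single u, Finset.sum_eq_single v, Finset.sum_eq_single y]
  · split_ifs <;> simp_all
  · intro z _ hz; simp [hz]
  · simp
  · intro z _ hz; simp [hz]
  · simp
  · intro z _ hz; simp [hz]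
  · simp

variable (PX PU PV : X → ℝ) (f : X → X → X) (PY : Y → ℝ) (ρ : X → Y → Matrix (C × E) (C × E) ℂ)

lemma marginalU_E_rateSplitState :
    marginalU_E (rateSplitState PU PV f PY ρ)
      = cqState PU (fun u => ∑ y, PY y • ∑ v, PV v • traceLeft (ρ (f u v) y)) := by
  ext ⟨u, e⟩ ⟨u', e'⟩
  simp only [marginalU_E, traceRight, of_apply, submatrix_apply, rateSplitState_apply,
    cqState_apply, if_true]
  split_ifs with h
  · simp only [traceLeft, Matrix.sum_apply, Matrix.smul_apply, of_apply, Fintype.sum_prod_type,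
      Complex.real_smul, Finset.mul_sum]
    rw [Finset.sum_comm]
    refine Finset.sum_congr rfl fun _ _ => Finset.sum_congr rfl fun _ _ =>
      Finset.sum_congr rfl fun _ _ => ?_
    push_cast
    ring
  · simp

/-- The register `U` becomes the block index, so this is the state to which conditional covering
applies with side information `U`. -/
lemma marginalY_EU_rateSplitState :
    marginalY_EU (rateSplitState PU PV f PY ρ)
      = cqState PY (fun y => blockDiagonal fun u =>
          PU u • ∑ v, PV v • traceLeft (ρ (f u v) y)) := by
  ext ⟨y, e, u⟩ ⟨y', e', u'⟩
  simp only [marginalY_EU, traceRight, of_apply, submatrix_apply, rateSplitState_apply,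
    cqState_apply, if_true, blockDiagonal_apply]
  split_ifs with h1 h2
  · simp only [traceLeft, Matrix.sum_apply, Matrix.smul_apply, of_apply, Fintype.sum_prod_type,
      Complex.real_smul, Finset.mul_sum]
    refine Finset.sum_congr rfl fun _ _ => Finset.sum_congr rfl fun _ _ => ?_
    push_cast
    ring
  all_goals simp

/-- Here the side information is the pair `(y, u)`, with product weights because the two are
independent. -/
lemma marginalV_EYU_rateSplitState :
    marginalV_EYU (rateSplitState PU PV f PY ρ)
      = cqState PV (fun v => blockDiagonal fun z : Y × X =>
          (PY z.1 * PU z.2) • traceLeft (ρ (f z.2 v) z.1)) := by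
  ext ⟨v, e, y, u⟩ ⟨v', e', y', u'⟩
  simp only [marginalV_EYU, traceRight, of_apply, submatrix_apply, rateSplitState_apply,
    cqState_apply, blockDiagonal_apply, Prod.mk.injEq]
  by_cases hu : u = u' <;> by_cases hv : v = v' <;> by_cases hy : y = y' <;> simp [hu, hv, hy]
  simp only [traceLeft, of_apply, Finset.mul_sum]
  refine Finset.sum_congr rfl fun _ _ => ?_
  ring

lemma traceLeft_controlState :
    traceLeft (traceLeft (traceLeft (controlState PX PY ρ)))
      = ∑ x, PX x • ∑ y, PY y • traceLeft (ρ x y) := by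
  ext e e'
  simp only [traceLeft, controlState, of_apply, Matrix.sum_apply, Matrix.smul_apply,
    kroneckerMap_apply, ketbra, single_apply, Complex.real_smul, Finset.mul_sum]
  have h : ∀ (c : C) (y : Y) (x : X), (∑ x', ∑ y', ((PX x' * PY y' : ℝ) : ℂ) *
      ((if x' = x ∧ x' = x then 1 else 0) * ((if y' = y ∧ y' = y then 1 else 0)
        * ρ x' y' (c, e) (c, e')))) = (PX x : ℂ) * (PY y * ρ x y (c, e) (c, e')) := by
    intro c y x
    simp [mul_assoc]
  simp only [h]
  rw [Finset.sum_comm]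
  conv_rhs => rw [Finset.sum_comm]
  exact Finset.sum_congr rfl fun _ _ => Finset.sum_comm

/-- Averaging over `f(U, V)` is averaging over `X`. -/
lemma RateSplit.sum_smul_sum_smul {M : Type*} [AddCommGroup M] [Module ℝ M] {PX : X → ℝ}
    (S : RateSplit PX) (θ : unitInterval) (g : X → M) :
    ∑ u, S.PU θ u • ∑ v, S.PV θ v • g (S.f u v) = ∑ x, PX x • g x := by
  have h1 : ∀ u, ∑ v, S.PV θ v • g (S.f u v) = ∑ x, splitLaw (S.PV θ) S.f u x • g x := by
    intro u
    simp only [splitLaw, Finset.sum_smul]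
    rw [Finset.sum_comm]
    refine Finset.sum_congr rfl fun v _ => ?_
    rw [Finset.sum_eq_single (S.f u v)]
    · simp
    · intro x _ hx
      rw [if_neg (Ne.symm hx), zero_smul]
    · simp
  simp only [h1, Finset.smul_sum, smul_smul]
  rw [Finset.sum_comm]
  refine Finset.sum_congr rfl fun x _ => ?_
  rw [← Finset.sum_smul, S.law_eq θ x]

end Marginals

/-! ### Rate comparison and the main theorem -/

/-- `ε' < δ` compares the cubes, and `-¼ log δ` is positive for `δ < 1`: the assumed rates exceed
what covering needs. -/
lemma logb_two_div_cube_le {δ ε' : ℝ} (hδ : 0 < δ) (hε' : 0 < ε') (h : ε' < δ) (hδ1 : δ < 1) :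
    Real.logb 2 (2 / δ ^ 3) ≤ Real.logb 2 (3 / ε' ^ 3) - 1 / 4 * Real.logb 2 δ := by
  have h1 : Real.logb 2 (2 / δ ^ 3) ≤ Real.logb 2 (3 / ε' ^ 3) := by
    apply Real.logb_le_logb_of_le (by norm_num) (by positivity)
    gcongr
    norm_num
  have h2 : Real.logb 2 δ < 0 := Real.logb_neg (by norm_num) hδ hδ1
  linarith


theorem mainTheorem3 :
    ∃ c : ℝ, ∀ (X Y C E : Type*) [Fintype X] [DecidableEq X] [Fintype Y] [DecidableEq Y]
      [Fintype C] [DecidableEq C] [Fintype E] [DecidableEq E]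
      (PX : X → ℝ) (_ : PX ∈ stdSimplex ℝ X) (PY : Y → ℝ) (_ : PY ∈ stdSimplex ℝ Y)
      (ρ : X → Y → Matrix (C × E) (C × E) ℂ) (_ : ∀ x y, IsState (ρ x y))
      (S : RateSplit PX) (θ : unitInterval)
      (δ ε' : ℝ) (_ : 0 < δ) (_ : 0 < ε') (_ : ε' < δ)
      (K₁ K₂ K₃ : ℕ) (_ : 0 < K₁) (_ : 0 < K₂) (_ : 0 < K₃),
      let ρθ := rateSplitState (S.PU θ) (S.PV θ) S.f PY ρ
      let ρE : Matrix E E ℂ := traceLeft (traceLeft (traceLeft (controlState PX PY ρ)))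
      smoothImax (δ - ε') (marginalU_E ρθ)
          + ((Real.logb 2 (3 / ε' ^ 3) - 1 / 4 * Real.logb 2 δ : ℝ) : EReal)
        ≤ ((Real.logb 2 K₁ : ℝ) : EReal) →
      smoothImax (δ - ε') (marginalY_EU ρθ)
          + ((Real.logb 2 (3 / ε' ^ 3) - 1 / 4 * Real.logb 2 δ + c : ℝ) : EReal)
        ≤ ((Real.logb 2 K₂ : ℝ) : EReal) →
      smoothImax (δ - ε') (marginalV_EYU ρθ)
          + ((Real.logb 2 (3 / ε' ^ 3) - 1 / 4 * Real.logb 2 δ + c : ℝ) : EReal)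
        ≤ ((Real.logb 2 K₃ : ℝ) : EReal) →
      iidExpect (S.PU θ) K₁ (fun u =>
        iidExpect PY K₂ (fun y =>
          iidExpect (S.PV θ) K₃ (fun v =>
            traceNorm ((1 / ((K₁ : ℝ) * K₂ * K₃)) •
              (∑ i, ∑ j, ∑ k, traceLeft (ρ (S.f (u i) (v k)) (y j))) - ρE))))
        ≤ 40 * δ ^ (1 / 8 : ℝ) := by
  -- The rate gap already suffices in all three covering steps, so no extra constant is needed.
  refine ⟨0, ?_⟩
  intro X Y C E _ _ _ _ _ _ _ _ PX hPX PY hPY ρ hρ S θ δ ε' hδ hε' hεδ K₁ K₂ K₃ hK₁ hK₂ hK₃ ρθ ρE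
    hU hY hV
  have hPU := S.PU_mem θ
  have hPV := S.PV_mem θ
  set s : X → Y → X → Matrix E E ℂ := fun u y v => traceLeft (ρ (S.f u v) y) with hs
  have hss : ∀ u y v, IsState (s u y v) := fun u y v => (hρ _ _).traceLeft
  have hρE : ρE = ∑ u, S.PU θ u • ∑ y, PY y • ∑ v, S.PV θ v • s u y v := by
    have h1 : ρE = ∑ x, PX x • ∑ y, PY y • traceLeft (ρ x y) := traceLeft_controlState PX PY ρ
    rw [h1, ← S.sum_smul_sum_smul θ fun x => ∑ y, PY y • traceLeft (ρ x y)]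
    refine Finset.sum_congr rfl fun u _ => ?_
    simp only [Finset.smul_sum, hs]
    rw [Finset.sum_comm]
    exact Finset.sum_congr rfl fun y _ => Finset.sum_congr rfl fun v _ => by
      rw [smul_comm (S.PV θ v)]
  have hρEs : IsState ρE := by
    rw [hρE]
    exact isState_sum_smul hPU fun u => isState_sum_smul hPY fun y =>
      isState_sum_smul hPV fun v => hss u y v
  -- For `δ ≥ 1` two states are at trace distance at most `2`, which is below `40 δ^(1/8)`.
  rcases le_or_gt 1 δ with hδ1 | hδ1
  · have hpt : ∀ (u : Fin K₁ → X) (y : Fin K₂ → Y) (v : Fin K₃ → X),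
        traceNorm ((1 / ((K₁ : ℝ) * K₂ * K₃)) • (∑ i, ∑ j, ∑ k, s (u i) (y j) (v k)) - ρE)
          ≤ 2 := by
      intro u y v
      have h1 : traceNorm (∑ i, ∑ j, ∑ k, s (u i) (y j) (v k)) ≤ (K₁ : ℝ) * K₂ * K₃ := by
        refine (traceNorm_sum_le _ _).trans ((Finset.sum_le_sum fun i _ =>
          (traceNorm_sum_le _ _).trans (Finset.sum_le_sum fun j _ =>
            traceNorm_sum_le _ _)).trans (le_of_eq ?_))
        simp only [(hss _ _ _).traceNorm_eq_one]
        simp [mul_assoc]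
      refine (traceNorm_sub_le _ _).trans ?_
      rw [hρEs.traceNorm_eq_one, traceNorm_smul (by positivity)]
      have h2 : (1 / ((K₁ : ℝ) * K₂ * K₃)) * traceNorm (∑ i, ∑ j, ∑ k, s (u i) (y j) (v k)) ≤ 1 := by
        rw [one_div, inv_mul_le_iff₀ (by positivity)]
        linarith
      linarith
    refine (iidExpect_mono hPU fun u => iidExpect_mono hPY fun y => iidExpect_mono hPV fun v =>
      hpt u y v).trans ?_
    rw [iidExpect_const hPV, iidExpect_const hPY, iidExpect_const hPU]
    linarith [Real.one_le_rpow hδ1 (by norm_num : (0 : ℝ) ≤ 1 / 8)]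
  have hη : 0 < δ - ε' := by linarith
  have hηδ : δ - ε' ≤ δ := by linarith
  have hg := logb_two_div_cube_le hδ hε' hεδ hδ1
  have hg' : Real.logb 2 (2 / δ ^ 3)
      ≤ Real.logb 2 (3 / ε' ^ 3) - 1 / 4 * Real.logb 2 δ + 0 := by linarith
  have hw : (fun z : Y × X => PY z.1 * S.PU θ z.2) ∈ stdSimplex ℝ (Y × X) := by
    refine ⟨fun z => mul_nonneg (hPY.1 _) (hPU.1 _), ?_⟩
    rw [Fintype.sum_prod_type]
    simp only [← Finset.mul_sum, hPU.2, hPY.2, mul_one]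
  rw [marginalU_E_rateSplitState] at hU
  rw [marginalY_EU_rateSplitState] at hY
  rw [marginalV_EYU_rateSplitState] at hV
  have b₁ := iidExpect_traceNorm_le_of_smoothImax_add_le hPU
    (fun u => isState_sum_smul hPY fun y => isState_sum_smul hPV fun v => hss u y v)
    hη hηδ hδ1 hK₁ hg hU
  have b₂ := sum_mul_iidExpect_traceNorm_le_of_smoothImax_add_le hPY hPU
    (r := fun y u => ∑ v, S.PV θ v • s u y v)
    (fun y u => isState_sum_smul hPV fun v => hss u y v) hη hηδ hδ1 hK₂ hg' hY
  have b₃ := sum_mul_iidExpect_traceNorm_le_of_smoothImax_add_le hPV hw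
    (r := fun v z => s z.2 z.1 v) (fun v z => hss _ _ _) hη hηδ hδ1 hK₃ hg' hV
  rw [Fintype.sum_prod_type, Finset.sum_comm] at b₃
  -- The three covering errors sum to `36 δ`, which this turns into the stated power.
  have hδ8 : δ ≤ δ ^ (1 / 8 : ℝ) := by
    have := Real.rpow_le_rpow_of_exponent_ge hδ hδ1.le (by norm_num : (1 / 8 : ℝ) ≤ 1)
    rwa [Real.rpow_one] at this
  have key := iidExpect_three_traceNorm_le hPU hPY hPV hK₁ hK₂ (K₃ := K₃) s
  rw [← hρE] at key
  refine key.trans ?_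
  have e₃ : ∑ u, S.PU θ u * ∑ y, PY y * iidExpect (S.PV θ) K₃ (fun v =>
      traceNorm ((K₃ : ℝ)⁻¹ • ∑ k, s u y (v k) - ∑ v, S.PV θ v • s u y v)) ≤ 12 * δ := by
    refine le_trans (le_of_eq ?_) b₃
    refine Finset.sum_congr rfl fun u _ => ?_
    rw [Finset.mul_sum]
    exact Finset.sum_congr rfl fun y _ => by ring
  rw [← hρE] at b₁
  linarith
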